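/- Let $G$ be a finite group, $p$ a prime, and $Z$ a subgroup of the center $Z(G)$ of order $p$. **Notation.** For a finite group $H$ let $\mathrm{Conj}(H)$ be the set of its conjugacy classes and $\mathrm{Irr}(H)$ the set of its irreducible complex characters. Harada's number of $H$ is $$h(H)=\prod_{K\in \mathrm{Conj}(H)}|K|\Big/\prod_{\chi\in\mathrm{Irr}(H)}\chi(1).$$ For $S\subseteq H$ write $[S]=\sum_{x\in S}[x]\in\mathbb{C}H$. On the center $Z(\mathbb{C}H)$ of the group algebra consider the Hermitian form $\langle u|v\rangle=\mathrm{tr}_{Z(\mathbb{C}H)}(\overline{u}\,v)$, where $\overline{\sum_x c_x[x]}=\sum_x\overline{c_x}[x^{-1}]$ and $\mathrm{tr}_{Z(\mathbb{C}H)}(w)$ is the trace of multiplication by $w$ on $Z(\mathbb{C}H)$. For a finite family $\mathcal{B}=(v_i)_i$ in $Z(\mathbb{C}H)$ put $\gamma(\mathcal{B})=|\det(\langle v_i|v_j\rangle)_{i,j}|$. Define $$\mu(H)=\frac{\gamma\big(([K])_{K\in\mathrm{Conj}(H)}\big)}{\prod_{K\in\mathrm{Conj}(H)}|C_H(x_K)|},\qquad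 x_K\in K.$$ For each $j\in\mathrm{Conj}(G/Z)$ choose $g_j\in G$ whose image in $G/Z$ lies in the class $j$, and let $K_j$ be the conjugacy class of $g_j$ in $G$. For a conjugacy class $K$ of $G$ put $\mathrm{Ann}_Z(K)=\{z\in Z: zK=K\}$, and for $N\le Z$ put $$I(G:Z)_N=\{j\in\mathrm{Conj}(G/Z): \mathrm{Ann}_Z(K_j)=N\}.$$ For $\phi\in\mathrm{Irr}(Z)$ let $e_\phi=\frac{1}{|Z|}\sum_{z\in Z}\overline{\phi(z)}[z]$ and $$\mu_\phi(G)=\frac{\gamma\big((e_\phi[K_j])_{\,j\in I(G:Z)_X,\ X\le\ker\phi}\big)}{\prod_{N\le\ker\phi}\ \prod_{j\in I(G:Z)_N}|C_G(g_j)|\,|Z/N|^{-1}}.$$ **Statement.** Let $\phi\in\mathrm{Irr}(Z)$ be nontrivial. Then, for every choice of the elements $g_j$, $$\mu(G)=p^{2|I(G:Z)_Z|}\,\mu(G/Z)\prod_{a\in(\mathbb{Z}/p\mathbb{Z})^\times}\mu_{\phi^a}(G).$$ If moreover $p>2$, then $$h(G)=p^{|I(G:Z)_Z|}\,h(G/Z)\prod_{a=1}^{(p-1)/2}\mu_{\phi^a}(G).$$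 -/

import Mathlib

noncomputable section

open scoped MonoidAlgebra Pointwise ComplexConjugate

namespace Harada

section CenterFacts

/-- An element of the group algebra commuting with every group element is central. -/
theorem mem_center_of_comm {G : Type*} [Group G] {u : ℂ[G]}
    (h : ∀ x : G, MonoidAlgebra.single x 1 * u = u * MonoidAlgebra.single x 1) :
    u ∈ Subalgebra.center ℂ ℂ[G] := by
  rw [Subalgebra.mem_center_iff]
  intro b
  induction b using MonoidAlgebra.induction_on with
  | of x => simpa [MonoidAlgebra.of_apply] using h x
  | add f g hf hg => rw [add_mul, mul_add, hf, hg]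
  | smul r f hf => rw [smul_mul_assoc, mul_smul_comm, hf]

end CenterFacts

/-- The set of irreducible complex characters of `G`: the trace functions of the irreducible
complex matrix representations of `G`. -/
def Irr (G : Type*) [Group G] : Set (G → ℂ) :=
  {χ | ∃ (n : ℕ) (ρ : Representation ℂ G (Fin n → ℂ)), ρ.IsIrreducible ∧ χ = ρ.character}

/-- Harada's number: the product of the sizes of the conjugacy classes divided by the product
of the degrees `χ(1)` of the irreducible characters. -/
def harada (G : Type*) [Group G] : ℂ :=
  (∏ᶠ K : ConjClasses G, (Nat.card K.carrier : ℂ)) / ∏ᶠ χ ∈ Irr G, χ 1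

/-- The semilinear anti-automorphism `∑ c_g [g] ↦ ∑ conj c_g [g⁻¹]` of the group algebra. -/
def bar {G : Type*} [Group G] [Finite G] (a : ℂ[G]) : ℂ[G] :=
  ∑ᶠ g : G, MonoidAlgebra.single g⁻¹ (conj (a.coeff g))

theorem coeff_bar {G : Type*} [Group G] [Finite G] (a : ℂ[G]) (x : G) :
    (bar a).coeff x = conj (a.coeff x⁻¹) := by
  classical
  have := Fintype.ofFinite G
  rw [bar, finsum_eq_sum_of_fintype]
  simp [MonoidAlgebra.coeff_sum, Finsupp.finsetSum_apply, MonoidAlgebra.coeff_single,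
    Finsupp.single_apply, inv_eq_iff_eq_inv]

theorem bar_mem_center {G : Type*} [Group G] [Finite G] {u : ℂ[G]}
    (hu : u ∈ Subalgebra.center ℂ ℂ[G]) : bar u ∈ Subalgebra.center ℂ ℂ[G] := by
  refine mem_center_of_comm fun x => ?_
  rw [Subalgebra.mem_center_iff] at hu
  ext y
  have h := congrArg (fun v : ℂ[G] => conj (v.coeff y⁻¹)) (hu (MonoidAlgebra.single x⁻¹ 1))
  simp at h
  simp [coeff_bar, h]

/-- The Hermitian form `⟨u | v⟩ = tr (bar u * v)` on the center of the group algebra, where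
`tr` is the trace of the multiplication operator on the center. -/
def form {G : Type*} [Group G] [Finite G] (u v : Subalgebra.center ℂ ℂ[G]) : ℂ :=
  Algebra.trace ℂ (Subalgebra.center ℂ ℂ[G])
    (⟨bar (u : ℂ[G]), bar_mem_center u.2⟩ * v)

open Classical in
/-- The absolute value of the Gramian determinant of a finite family of central elements. -/
def gram {G : Type*} [Group G] [Finite G] {ι : Type*} [Finite ι]
    (v : ι → Subalgebra.center ℂ ℂ[G]) : ℝ :=
  letI := Fintype.ofFinite ι
  ‖(Matrix.of fun i j => form (v i) (v j)).det‖

/-- The class sum `[K] = ∑_{g ∈ K} [g]`, as an element of the group algebra. -/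
def classSumAux {G : Type*} [Group G] [Finite G] (K : ConjClasses G) : ℂ[G] :=
  ∑ᶠ g ∈ K.carrier, MonoidAlgebra.single g 1

theorem classSumAux_mem_center {G : Type*} [Group G] [Finite G] (K : ConjClasses G) :
    classSumAux K ∈ Subalgebra.center ℂ ℂ[G] := by
  classical
  have := Fintype.ofFinite G
  have hc : ∀ x : G, (classSumAux K).coeff x = if ConjClasses.mk x = K then 1 else 0 := by
    intro x
    rw [classSumAux, finsum_mem_eq_finite_toFinset_sum _ (Set.toFinite _)]
    simp [MonoidAlgebra.coeff_sum, Finsupp.finsetSum_apply, MonoidAlgebra.coeff_single,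
      Finsupp.single_apply, ConjClasses.mem_carrier_iff_mk_eq]
  refine mem_center_of_comm fun x => ?_
  ext y
  have h : ConjClasses.mk (x⁻¹ * y) = ConjClasses.mk (y * x⁻¹) := by
    rw [ConjClasses.mk_eq_mk_iff_isConj, isConj_iff]
    exact ⟨x, by group⟩
  simp [hc, h]

/-- The class sum `[K]`, as an element of the center of the group algebra. -/
def classSum {G : Type*} [Group G] [Finite G] (K : ConjClasses G) :
    Subalgebra.center ℂ ℂ[G] :=
  ⟨classSumAux K, classSumAux_mem_center K⟩

/-- `γ(G)`: the Gramian of the basis of class sums. -/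
def gamma (G : Type*) [Group G] [Finite G] : ℝ :=
  gram (fun K : ConjClasses G => classSum K)

/-- `c(G)`: the product of the orders of the centralizers of representatives of the
conjugacy classes. -/
def cent (G : Type*) [Group G] : ℝ :=
  ∏ᶠ K : ConjClasses G, (Nat.card (Subgroup.centralizer {(Quotient.out K : G)}) : ℝ)

/-- `μ(G) = γ(G) / c(G)`. -/
def mu (G : Type*) [Group G] [Finite G] : ℝ := gamma G / cent G

section Central

variable {G : Type*} [Group G] {Z : Subgroup G}

/-- The element `e_φ = |Z|⁻¹ ∑_{z ∈ Z} conj (φ z) [z]` of the group algebra. -/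
def idemAux (φ : Z → ℂ) : ℂ[G] :=
  (Nat.card Z : ℂ)⁻¹ • ∑ᶠ z : Z, MonoidAlgebra.single (z : G) (conj (φ z))

theorem idemAux_mem_center [Finite G] (hZ : Z ≤ Subgroup.center G) (φ : Z → ℂ) :
    idemAux φ ∈ Subalgebra.center ℂ ℂ[G] := by
  have := Fintype.ofFinite Z
  refine Subalgebra.smul_mem _ ?_ _
  rw [finsum_eq_sum_of_fintype]
  refine Subalgebra.sum_mem _ fun z _ => mem_center_of_comm fun x => ?_
  have h : x * (z : G) = z * x := Subgroup.mem_center_iff.1 (hZ z.2) x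
  simp [MonoidAlgebra.single_mul_single, h]

/-- `e_φ` as an element of the center of the group algebra, for `Z` central. -/
def idem [Finite G] (hZ : Z ≤ Subgroup.center G) (φ : Z → ℂ) : Subalgebra.center ℂ ℂ[G] :=
  ⟨idemAux φ, idemAux_mem_center hZ φ⟩

/-- `Ann_Z(K) = {z ∈ Z | zK = K}`. -/
def ann (Z : Subgroup G) (K : ConjClasses G) : Subgroup Z :=
  MulAction.stabilizer Z K.carrier

/-- The kernel `{z | φ z = φ 1}` of a character. -/
def charKer (φ : Z → ℂ) : Set Z := {z | φ z = φ 1}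

variable [Z.Normal]

/-- `I(G:Z)_N`: the indices `j` (conjugacy classes of `G/Z`) such that the chosen class
`K_j` of `g j` has annihilator `N`. -/
def idx (g : ConjClasses (G ⧸ Z) → G) (N : Subgroup Z) : Set (ConjClasses (G ⧸ Z)) :=
  {j | ann Z (ConjClasses.mk (g j)) = N}

/-- The indices of the basis `B(G)_φ`: the union of the `I(G:Z)_X` over `X ≤ Ker φ`. -/
def basisIdx (g : ConjClasses (G ⧸ Z) → G) (φ : Z → ℂ) : Set (ConjClasses (G ⧸ Z)) :=
  {j | ∃ X : Subgroup Z, (X : Set Z) ⊆ charKer φ ∧ j ∈ idx g X}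

/-- `γ_φ(G)`: the Gramian of the basis `B(G)_φ = {e_φ [K_j]}`. -/
def gammaChar [Finite G] (hZ : Z ≤ Subgroup.center G) (g : ConjClasses (G ⧸ Z) → G)
    (φ : Z → ℂ) : ℝ :=
  gram (fun j : basisIdx g φ => idem hZ φ * classSum (ConjClasses.mk (g j)))

/-- `c_φ(G)`: the product of `|C_G(g_j)| |Z/N|⁻¹` over `N ≤ Ker φ` and `j ∈ I(G:Z)_N`. -/
def centChar (g : ConjClasses (G ⧸ Z) → G) (φ : Z → ℂ) : ℝ :=
  ∏ᶠ (N : Subgroup Z) (_ : (N : Set Z) ⊆ charKer φ), ∏ᶠ j ∈ idx g N,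
    (Nat.card (Subgroup.centralizer {g j}) : ℝ) / (Nat.card (Z ⧸ N) : ℝ)

/-- `μ_φ(G) = γ_φ(G) / c_φ(G)`. -/
def muChar [Finite G] (hZ : Z ≤ Subgroup.center G) (g : ConjClasses (G ⧸ Z) → G)
    (φ : Z → ℂ) : ℝ :=
  gammaChar hZ g φ / centChar g φ

end Central

end Harada

end

noncomputable section

open scoped MonoidAlgebra Pointwise ComplexConjugate

namespace Harada

/-! ### The center of the group algebra, its two forms and the trace -/

section GroupAlgebra

variable {G : Type*} [Group G]

/-! Besides the trace form, the center carries the simpler form `coeffForm`, for which the class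
sums are orthogonal with square norms |K|. A Wedderburn decomposition with block sizes d_i
identifies the center with a power of ℂ; there the trace of c is ∑ c_i, while |G| times the
coefficient of 1 is ∑ d_i² c_i. Comparing determinants on the class sums gives γ(G) ∏ d_i² = ∏
|G||K|, which means μ(G) = h(G)² (`det_form_classSum_mul`, `exists_harada_sq`).

The Gramians of the two forms change by the same factor when the class sums are replaced by another
family (`gram_mul_prod_card`). Take the family of all e_χ[K_j] with χ a character of Z trivial on
Ann(K_j). On it `coeffForm` is diagonal with entries |K_j||Ann(K_j)|/|Z|, and the trace form is
block diagonal because the e_χ are orthogonal idempotents. The factors |Ann|/|Z| are exactly those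
built into c_χ, so μ(G) is the product of the μ_χ(G) (`mu_eq_prod_muChar`). The family has the right
size because |Z|/|Ann(K_j)| classes of G lie over j, as many as there are characters of Z trivial on
Ann(K_j) (`exists_equiv_sigma_basisIdx`).

For trivial χ, projection to ℂ[G/Z] preserves traces on the e_1 part and sends [K_j] to
|Ann(K_j)|[j]; this gives μ_1(G) = (∏ |Ann(K_j)|)² μ(G/Z), and the product of the |Ann(K_j)| is p to
the power |I(G:Z)_Z| (`muChar_one`, `prod_card_ann`). The first identity follows. For the second,
complex conjugate characters have equal μ_χ, so a and p - a pair off, and the square root of an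
identity between nonnegative reals is taken. -/

theorem coeff_mul_eq_sum [Fintype G] (x y : ℂ[G]) (g : G) :
    (x * y).coeff g = ∑ h, x.coeff h * y.coeff (h⁻¹ * g) := by
  rw [MonoidAlgebra.coeff_mul_apply_left, Finsupp.sum_fintype]
  simp

theorem coeff_classSum [Finite G] [DecidableEq (ConjClasses G)] (K : ConjClasses G) (x : G) :
    ((classSum K : Subalgebra.center ℂ ℂ[G]) : ℂ[G]).coeff x =
      if ConjClasses.mk x = K then 1 else 0 := by
  classical
  have := Fintype.ofFinite G
  change (classSumAux K).coeff x = _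
  rw [classSumAux, finsum_mem_eq_finite_toFinset_sum _ (Set.toFinite _)]
  simp [MonoidAlgebra.coeff_sum, Finsupp.finsetSum_apply, MonoidAlgebra.coeff_single,
    Finsupp.single_apply, ConjClasses.mem_carrier_iff_mk_eq]

theorem coeff_conj_of_mem_center {u : ℂ[G]} (hu : u ∈ Subalgebra.center ℂ ℂ[G]) (g x : G) :
    u.coeff (g * x * g⁻¹) = u.coeff x := by
  rw [Subalgebra.mem_center_iff] at hu
  have h := congrArg (fun v : ℂ[G] => v.coeff (g * x)) (hu (MonoidAlgebra.single g 1))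
  simpa using h.symm

theorem coeff_eq_of_mk_eq {u : ℂ[G]} (hu : u ∈ Subalgebra.center ℂ ℂ[G]) {x y : G}
    (h : ConjClasses.mk x = ConjClasses.mk y) : u.coeff x = u.coeff y := by
  rw [ConjClasses.mk_eq_mk_iff_isConj, isConj_iff] at h
  obtain ⟨c, rfl⟩ := h
  exact (coeff_conj_of_mem_center hu c x).symm

variable [Finite G]

theorem center_eq_sum [Fintype (ConjClasses G)] (u : Subalgebra.center ℂ ℂ[G]) :
    u = ∑ K : ConjClasses G, (u : ℂ[G]).coeff (Quotient.out K) • classSum K := by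
  classical
  ext x
  simp only [AddSubmonoidClass.coe_finsetSum, SetLike.val_smul, MonoidAlgebra.coeff_sum,
    Finsupp.finsetSum_apply, MonoidAlgebra.coeff_smul, Finsupp.smul_apply, coeff_classSum]
  simp only [smul_eq_mul, mul_ite, mul_one, mul_zero, Finset.sum_ite_eq, Finset.mem_univ, if_true]
  exact coeff_eq_of_mk_eq u.2 (Quotient.out_eq (ConjClasses.mk x)).symm

theorem sum_coeff_classSum [Fintype G] (K : ConjClasses G) (f : G → ℂ) (c : ℂ)
    (hf : ∀ x ∈ K.carrier, f x = c) :
    ∑ x, ((classSum K : Subalgebra.center ℂ ℂ[G]) : ℂ[G]).coeff x * f x =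
      Nat.card K.carrier * c := by
  classical
  simp only [coeff_classSum, ite_mul, one_mul, zero_mul]
  rw [← Finset.sum_filter, Finset.sum_congr rfl (g := fun _ => c), Finset.sum_const, nsmul_eq_mul]
  · congr 2
    rw [Nat.card_eq_fintype_card, ← Set.toFinset_card]
    congr 1
    ext x
    simp [ConjClasses.mem_carrier_iff_mk_eq]
  · intro x hx
    exact hf x (by simpa [ConjClasses.mem_carrier_iff_mk_eq] using hx)

theorem bar_mul (u v : ℂ[G]) : bar (u * v) = bar v * bar u := by
  have := Fintype.ofFinite G
  ext x
  simp only [coeff_bar, coeff_mul_eq_sum, map_sum, map_mul]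
  refine Fintype.sum_equiv (Equiv.mulLeft x) _ _ fun h => ?_
  simp [mul_comm]

theorem bar_add (u v : ℂ[G]) : bar (u + v) = bar u + bar v := by
  ext x
  simp [coeff_bar]

theorem bar_smul (c : ℂ) (u : ℂ[G]) : bar (c • u) = conj c • bar u := by
  ext x
  simp [coeff_bar]

/-- `bar` as a semilinear endomorphism of the center. -/
def barCenter : Subalgebra.center ℂ ℂ[G] →ₗ⋆[ℂ] Subalgebra.center ℂ ℂ[G] where
  toFun u := ⟨bar (u : ℂ[G]), bar_mem_center u.2⟩
  map_add' _ _ := Subtype.ext (bar_add _ _)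
  map_smul' _ _ := Subtype.ext (bar_smul _ _)

theorem coe_barCenter (u : Subalgebra.center ℂ ℂ[G]) :
    (barCenter u : ℂ[G]) = bar (u : ℂ[G]) := rfl

theorem barCenter_mul (u v : Subalgebra.center ℂ ℂ[G]) :
    barCenter (u * v) = barCenter u * barCenter v :=
  Subtype.ext <| by
    rw [mul_comm (barCenter u)]
    exact bar_mul _ _

theorem form_eq (u v : Subalgebra.center ℂ ℂ[G]) :
    form u v = Algebra.trace ℂ _ (barCenter u * v) := rfl

/-- The orthogonal form `∑ conj (u x) (v x)` of the center, the coefficient of `1` in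
`bar u * v`. -/
def coeffForm (u v : Subalgebra.center ℂ ℂ[G]) : ℂ :=
  ((barCenter u * v : Subalgebra.center ℂ ℂ[G]) : ℂ[G]).coeff 1

theorem coeffForm_eq_sum [Fintype G] (u v : Subalgebra.center ℂ ℂ[G]) :
    coeffForm u v = ∑ x, conj ((u : ℂ[G]).coeff x) * (v : ℂ[G]).coeff x := by
  rw [coeffForm, MulMemClass.coe_mul, coeff_mul_eq_sum]
  refine Fintype.sum_equiv (Equiv.inv G) _ _ fun h => ?_
  simp [coe_barCenter, coeff_bar]

theorem coeffForm_classSum [DecidableEq (ConjClasses G)] (K L : ConjClasses G) :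
    coeffForm (classSum K) (classSum L) = if K = L then (Nat.card K.carrier : ℂ) else 0 := by
  have := Fintype.ofFinite G
  rw [coeffForm_eq_sum]
  have h := sum_coeff_classSum K (fun x => ((classSum L : Subalgebra.center ℂ ℂ[G]) : ℂ[G]).coeff x)
    (if K = L then 1 else 0) (by
      intro x hx
      rw [ConjClasses.mem_carrier_iff_mk_eq] at hx
      rw [coeff_classSum, hx])
  rw [mul_ite, mul_one, mul_zero] at h
  rw [← h]
  refine Finset.sum_congr rfl fun x _ => ?_
  rw [coeff_classSum K x]
  split_ifs <;> simp

/-- The projection of the group algebra onto its center that averages over conjugates. -/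
def averageConj (G : Type*) [Group G] [Fintype G] : ℂ[G] →ₗ[ℂ] ℂ[G] :=
  (Nat.card G : ℂ)⁻¹ • ∑ g : G, LinearMap.mulLeftRight ℂ
    (MonoidAlgebra.single g 1, MonoidAlgebra.single g⁻¹ 1)

omit [Finite G] in
theorem coeff_averageConj [Fintype G] (u : ℂ[G]) (x : G) :
    (averageConj G u).coeff x = (Nat.card G : ℂ)⁻¹ * ∑ g : G, u.coeff (g * x * g⁻¹) := by
  simp only [averageConj, LinearMap.smul_apply, LinearMap.sum_apply, LinearMap.mulLeftRight_apply,
    MonoidAlgebra.coeff_smul, MonoidAlgebra.coeff_sum, Finsupp.smul_apply, Finsupp.finsetSum_apply,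
    smul_eq_mul]
  congr 1
  refine Fintype.sum_equiv (Equiv.inv G) _ _ fun h => ?_
  simp [mul_assoc]

omit [Finite G] in
theorem averageConj_mem_center [Fintype G] (u : ℂ[G]) :
    averageConj G u ∈ Subalgebra.center ℂ ℂ[G] := by
  refine mem_center_of_comm fun x => ?_
  ext y
  simp only [MonoidAlgebra.coeff_single_mul_apply, MonoidAlgebra.coeff_mul_single_apply, one_mul,
    mul_one, coeff_averageConj]
  congr 1
  refine Fintype.sum_equiv (Equiv.mulRight x⁻¹) _ _ fun h => ?_
  simp [mul_assoc]

omit [Finite G] in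
theorem averageConj_of_mem_center [Fintype G] {u : ℂ[G]} (hu : u ∈ Subalgebra.center ℂ ℂ[G]) :
    averageConj G u = u := by
  ext x
  rw [coeff_averageConj]
  simp [coeff_conj_of_mem_center hu]

/-- Multiplication by `w` on the center is the restriction of `u ↦ w * averageConj G u`, whose image
lies in the center, so the two traces agree; the second is read off in the basis of group elements.
Only coefficients of `w` occur, which permits comparison with G/Z and complex conjugation. -/
theorem trace_center_eq_sum [Fintype G] (w : Subalgebra.center ℂ ℂ[G]) :
    Algebra.trace ℂ _ w =
      (Nat.card G : ℂ)⁻¹ * ∑ x : G, ∑ g : G, (w : ℂ[G]).coeff (x * (g * x * g⁻¹)⁻¹) := by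
  classical
  let f : ℂ[G] →ₗ[ℂ] ℂ[G] := LinearMap.mulLeft ℂ (w : ℂ[G]) ∘ₗ averageConj G
  have hf : ∀ u, f u ∈ Subalgebra.toSubmodule (Subalgebra.center ℂ ℂ[G]) := fun u =>
    Subalgebra.mul_mem _ w.2 (averageConj_mem_center u)
  have h := LinearMap.trace_restrict_eq_of_forall_mem _ f hf
  have h2 : Algebra.trace ℂ _ w = LinearMap.trace ℂ _ f := by
    rw [← h]
    refine congrArg (LinearMap.trace ℂ (Subalgebra.toSubmodule (Subalgebra.center ℂ ℂ[G]))) ?_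
    refine LinearMap.ext fun u => Subtype.ext ?_
    change (w : ℂ[G]) * u = w * averageConj G (u : ℂ[G])
    rw [averageConj_of_mem_center u.2]
  rw [h2, LinearMap.trace_eq_matrix_trace ℂ (MonoidAlgebra.basis G ℂ), Matrix.trace,
    Finset.mul_sum]
  refine Finset.sum_congr rfl fun x _ => ?_
  rw [Matrix.diag_apply, LinearMap.toMatrix_apply]
  have h3 : ∀ v : ℂ[G], (MonoidAlgebra.basis G ℂ).repr v x = v.coeff x := fun v => rfl
  have h4 : MonoidAlgebra.basis G ℂ x = MonoidAlgebra.single x 1 := by simp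
  rw [h3, h4]
  change ((w : ℂ[G]) * averageConj G (MonoidAlgebra.single x 1)).coeff x = _
  simp only [averageConj, LinearMap.smul_apply, LinearMap.sum_apply, LinearMap.mulLeftRight_apply,
    MonoidAlgebra.single_mul_single, mul_smul_comm, Finset.mul_sum, MonoidAlgebra.coeff_smul,
    MonoidAlgebra.coeff_sum, Finsupp.smul_apply, Finsupp.finsetSum_apply, smul_eq_mul,
    MonoidAlgebra.coeff_mul_single_apply, mul_one]

end GroupAlgebra

/-! ### Wedderburn blocks, irreducible characters and coordinates on the center -/

section Wedderburn

variable {G : Type*} [Group G] {ι : Type*} {d : ι → ℕ}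
  (e : ℂ[G] ≃ₐ[ℂ] (i : ι) → Matrix (Fin (d i)) (Fin (d i)) ℂ)

/-- The representation of `G` on the `i`-th block of a Wedderburn decomposition. -/
def blockRep (i : ι) : Representation ℂ G (Fin (d i) → ℂ) :=
  ((Matrix.toLinAlgEquiv'.toAlgHom.comp
    ((Pi.evalAlgHom ℂ _ i).comp e.toAlgHom) :
      ℂ[G] →ₐ[ℂ] Module.End ℂ (Fin (d i) → ℂ)) : ℂ[G] →* _).comp (MonoidAlgebra.of ℂ G)

theorem blockRep_apply (i : ι) (g : G) (v : Fin (d i) → ℂ) :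
    blockRep e i g v = (e (MonoidAlgebra.single g 1) i).mulVec v := rfl

theorem asAlgebraHom_blockRep (i : ι) (a : ℂ[G]) :
    (blockRep e i).asAlgebraHom a = Matrix.toLin' (e a i) := by
  have h : (blockRep e i).asAlgebraHom = Matrix.toLinAlgEquiv'.toAlgHom.comp
      ((Pi.evalAlgHom ℂ _ i).comp e.toAlgHom) := by
    refine MonoidAlgebra.algHom_ext (fun g => ?_) (AlgHom.ext fun c => ?_)
    · rw [Representation.asAlgebraHom_single_one]
      rfl
    · exact ((blockRep e i).asAlgebraHom.commutes c).trans (AlgHom.commutes _ c).symm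
  rw [h]
  rfl

theorem blockRep_isIrreducible [DecidableEq ι] (i : ι) [NeZero (d i)] : (blockRep e i).IsIrreducible := by
  rw [Representation.irreducible_iff_isSimpleModule_asModule,
    isSimpleModule_iff_toSpanSingleton_surjective]
  refine ⟨inferInstanceAs (Nontrivial (Fin (d i) → ℂ)), fun v hv w => ?_⟩
  change Fin (d i) → ℂ at v w
  obtain ⟨k, hk⟩ := Function.ne_iff.1 hv
  -- The rank one matrix w (v k)⁻¹ e_kᵀ sends v to w.
  refine ⟨e.symm (Pi.single i (Matrix.vecMulVec w (Pi.single k (v k)⁻¹))), ?_⟩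
  change (blockRep e i).asAlgebraHom _ v = w
  rw [asAlgebraHom_blockRep]
  have hk' : v k ≠ 0 := hk
  ext l
  simp [Matrix.toLin'_apply, Matrix.vecMulVec_mulVec, hk']

/-- Fix v ≠ 0. Placing w in column k of block i and letting the result act on v defines an
intertwining map `f i k`. By Schur's lemma each is bijective or zero; if all vanished, then 1, the
sum of the diagonal matrix units, would kill v. -/
theorem exists_equiv_blockRep [Fintype ι] {V : Type*} [AddCommGroup V] [Module ℂ V] [∀ i, NeZero (d i)]
    (ρ : Representation ℂ G V) [ρ.IsIrreducible] :
    ∃ i, Nonempty ((blockRep e i).Equiv ρ) := by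
  classical
  have : Nontrivial V := by
    have := (Representation.irreducible_iff_isSimpleModule_asModule ρ).1 inferInstance
    exact IsSimpleModule.nontrivial ℂ[G] ρ.asModule
  obtain ⟨v, hv⟩ := exists_ne (0 : V)
  let f (i : ι) (k : Fin (d i)) : (blockRep e i).IntertwiningMap ρ :=
    { toFun := fun w => ρ.asAlgebraHom
        (e.symm (Pi.single i (Matrix.vecMulVec w (Pi.single k 1)))) v
      map_add' := fun w w' => by
        simp [Matrix.add_vecMulVec, Pi.single_add]
      map_smul' := fun c w => by
        simp [Matrix.smul_vecMulVec, Pi.single_smul]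
      isIntertwining' := fun g => by
        refine LinearMap.ext fun w => ?_
        have h1 : e.symm (Pi.single i (Matrix.vecMulVec (blockRep e i g w) (Pi.single k 1))) =
            MonoidAlgebra.single g 1 *
              e.symm (Pi.single i (Matrix.vecMulVec w (Pi.single k 1))) := by
          apply e.injective
          rw [map_mul, e.apply_symm_apply, e.apply_symm_apply, blockRep_apply,
            ← Matrix.mul_vecMulVec, Pi.single_mul_right]
        change ρ.asAlgebraHom _ v = ρ g (ρ.asAlgebraHom _ v)
        rw [h1, map_mul, Representation.asAlgebraHom_single_one]
        rfl }
  by_contra! h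
  have hf : ∀ i k, f i k = 0 := fun i k => by
    have := blockRep_isIrreducible e i
    refine (Representation.IsIrreducible.bijective_or_eq_zero (f i k)).resolve_left fun hb => ?_
    exact (h i).elim ((f i k).ofBijective hb)
  have h1 : (1 : (i : ι) → Matrix (Fin (d i)) (Fin (d i)) ℂ) =
      ∑ i, ∑ k : Fin (d i), Pi.single i
        (Matrix.vecMulVec (Pi.single k (1 : ℂ)) (Pi.single k (1 : ℂ))) := by
    rw [← Finset.univ_sum_single (1 : (i : ι) → Matrix (Fin (d i)) (Fin (d i)) ℂ)]
    refine Finset.sum_congr rfl fun i _ => ?_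
    refine Eq.trans (congrArg (Pi.single i) ?_)
      (map_sum (AddMonoidHom.single (fun i => Matrix (Fin (d i)) (Fin (d i)) ℂ) i) _ _)
    ext k l
    simp [Matrix.sum_apply, Matrix.vecMulVec_apply, Matrix.one_apply, Pi.single_apply]
  refine hv ?_
  have h2 : ρ.asAlgebraHom (e.symm 1) v = v := by simp
  rw [← h2, h1]
  simp only [map_sum, LinearMap.sum_apply]
  exact Finset.sum_eq_zero fun i _ => Finset.sum_eq_zero fun k _ =>
    congrArg (fun F => F (Pi.single k 1)) (hf i k)

/-- The unit of block i has trace d_i ≠ 0 on block i and trace 0 on every other block. -/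
theorem character_blockRep_injective [DecidableEq ι] [∀ i, NeZero (d i)] :
    Function.Injective fun i => (blockRep e i).character := by
  intro i j hij
  by_contra hne
  have hij' : (blockRep e i).character = (blockRep e j).character := hij
  have h : ∀ a : ℂ[G], ∀ i, LinearMap.trace ℂ _ (Matrix.toLin' (e a i)) =
      a.coeff.sum fun g c => c * (blockRep e i).character g := by
    intro a i
    rw [← asAlgebraHom_blockRep, Representation.asAlgebraHom_def, MonoidAlgebra.lift_apply,
      Finsupp.sum, map_sum]
    simp [Finsupp.sum, Representation.character]
  have h1 := (h (e.symm (Pi.single i 1)) i).trans ((h (e.symm (Pi.single i 1)) j).trans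
    (by simp only [hij'])).symm
  rw [AlgEquiv.apply_symm_apply, Pi.single_eq_same, Pi.single_eq_of_ne (Ne.symm hne)] at h1
  simp [NeZero.ne] at h1

theorem Irr_eq_range [Fintype ι] [∀ i, NeZero (d i)] : Irr G = Set.range fun i => (blockRep e i).character := by
  classical
  ext χ
  constructor
  · rintro ⟨n, ρ, hρ, rfl⟩
    obtain ⟨i, ⟨E⟩⟩ := exists_equiv_blockRep e ρ
    exact ⟨i, Representation.char_iso E⟩
  · rintro ⟨i, rfl⟩
    exact ⟨d i, blockRep e i, blockRep_isIrreducible e i, rfl⟩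

include e in
theorem finprod_Irr [Fintype ι] [∀ i, NeZero (d i)] : ∏ᶠ χ ∈ Irr G, χ 1 = ∏ i, (d i : ℂ) := by
  classical
  rw [Irr_eq_range e, finprod_mem_range (character_blockRep_injective e),
    finprod_eq_prod_of_fintype]
  simp

/-- The tuple of scalars `c` as the central element that acts by `c i` on the `i`-th block of a
Wedderburn decomposition. -/
def scalarHom : (ι → ℂ) →ₐ[ℂ] Subalgebra.center ℂ ℂ[G] :=
  (e.symm.toAlgHom.comp
    (AlgHom.pi fun i => (Algebra.ofId ℂ _).comp (Pi.evalAlgHom ℂ (fun _ : ι => ℂ) i))).codRestrict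
    _ fun c => by
      rw [Subalgebra.mem_center_iff]
      intro b
      apply e.injective
      ext1 i
      simp [Algebra.ofId_apply, (Algebra.commutes (c i) (e b i))]

theorem apply_scalarHom (c : ι → ℂ) (i : ι) :
    e (scalarHom e c : ℂ[G]) i = algebraMap ℂ _ (c i) := by
  change e (e.symm _) i = _
  rw [AlgEquiv.apply_symm_apply]
  rfl

theorem scalarHom_bijective [∀ i, NeZero (d i)] : Function.Bijective (scalarHom e) := by
  constructor
  · intro c c' h
    ext i
    have h1 := apply_scalarHom e c i
    rw [h, apply_scalarHom] at h1
    exact ((algebraMap ℂ (Matrix (Fin (d i)) (Fin (d i)) ℂ)).injective h1).symm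
  · classical
    intro u
    have h : ∀ i, ∃ c : ℂ, algebraMap ℂ _ c = e (u : ℂ[G]) i := by
      intro i
      change e (u : ℂ[G]) i ∈ Set.range (algebraMap ℂ (Matrix (Fin (d i)) (Fin (d i)) ℂ))
      rw [← Algebra.mem_bot, ← Algebra.IsCentral.center_eq_bot ℂ (Matrix (Fin (d i)) (Fin (d i)) ℂ),
        Subalgebra.mem_center_iff]
      -- Commuting with elements supported on block i alone makes the i-th component central in its
      -- matrix algebra, hence scalar.
      intro M
      have h1 := congrArg (fun v => e v i) (Subalgebra.mem_center_iff.1 u.2 (e.symm (Pi.single i M)))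
      simpa using h1
    choose c hc using h
    refine ⟨c, Subtype.ext (e.injective (funext fun i => ?_))⟩
    rw [apply_scalarHom, hc]

/-- The isomorphism of the center with a product of copies of `ℂ` given by a Wedderburn
decomposition. -/
def centerEquiv [∀ i, NeZero (d i)] : (ι → ℂ) ≃ₐ[ℂ] Subalgebra.center ℂ ℂ[G] :=
  AlgEquiv.ofBijective (scalarHom e) (scalarHom_bijective e)

theorem trace_centerEquiv [Fintype ι] [∀ i, NeZero (d i)] (c : ι → ℂ) :
    Algebra.trace ℂ _ (centerEquiv e c) = ∑ i, c i := by
  classical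
  rw [Algebra.trace_eq_of_algEquiv, Algebra.trace_eq_matrix_trace (Pi.basisFun ℂ ι), Matrix.trace]
  simp [Algebra.leftMulMatrix_eq_repr_mul]

theorem card_mul_coeff_one [Finite G] (a : ℂ[G]) :
    (Nat.card G : ℂ) * a.coeff 1 = LinearMap.trace ℂ _ (LinearMap.mulLeft ℂ a) := by
  classical
  have := Fintype.ofFinite G
  rw [LinearMap.trace_eq_matrix_trace ℂ (MonoidAlgebra.basis G ℂ), Matrix.trace]
  have h : ∀ (v : ℂ[G]) x, (MonoidAlgebra.basis G ℂ).repr v x = v.coeff x := fun v x => rfl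
  simp only [Matrix.diag_apply, LinearMap.toMatrix_apply, h]
  simp

/-- Both sides are the trace on the regular representation: c acts as the scalar c_i on block i, of
dimension d_i². These weights are what separates `coeffForm` from the trace form. -/
theorem card_mul_coeff_one_centerEquiv [Fintype ι] [Finite G] [∀ i, NeZero (d i)] (c : ι → ℂ) :
    (Nat.card G : ℂ) * (centerEquiv e c : ℂ[G]).coeff 1 = ∑ i, (d i : ℂ) ^ 2 * c i := by
  classical
  rw [card_mul_coeff_one, ← LinearMap.trace_conj' _ e.toLinearEquiv]
  let b := Pi.basis fun i => Matrix.stdBasis ℂ (Fin (d i)) (Fin (d i))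
  have h : e.toLinearEquiv.conj (LinearMap.mulLeft ℂ (centerEquiv e c : ℂ[G])) =
      LinearMap.mulLeft ℂ (e (centerEquiv e c : ℂ[G])) := by
    refine LinearMap.ext fun x => ?_
    simp [LinearEquiv.conj_apply]
  rw [h, LinearMap.trace_eq_matrix_trace ℂ b, Matrix.trace]
  have h2 : ∀ x, LinearMap.toMatrix b b (LinearMap.mulLeft ℂ (e (centerEquiv e c : ℂ[G]))) x x =
      c x.1 := by
    rintro ⟨i, k, l⟩
    have h3 : e (centerEquiv e c : ℂ[G]) * b ⟨i, k, l⟩ = c i • b ⟨i, k, l⟩ := by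
      have h4 : e (centerEquiv e c : ℂ[G]) = fun i => algebraMap ℂ _ (c i) :=
        funext fun i => apply_scalarHom e c i
      have h5 : b ⟨i, k, l⟩ = Pi.single i (Matrix.stdBasis ℂ (Fin (d i)) (Fin (d i)) (k, l)) := by
        simp [b]
      rw [h4, h5, ← Pi.single_mul_right, ← Algebra.smul_def, Pi.single_smul]
    rw [LinearMap.toMatrix_apply, LinearMap.mulLeft_apply, h3]
    simp
  simp only [Matrix.diag_apply, h2]
  rw [Fintype.sum_sigma]
  simp [sq]

end Wedderburn

/-! ### Gramians, Harada's number and change of family -/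

section Gram

variable {G : Type*} [Group G]

theorem card_carrier_mul_card_centralizer [Finite G] (g : G) :
    Nat.card (ConjClasses.mk g).carrier * Nat.card (Subgroup.centralizer {g}) = Nat.card G := by
  classical
  have := Fintype.ofFinite G
  rw [Subgroup.nat_card_centralizer_nat_card_stabilizer, ← ConjAct.orbit_eq_carrier_conjClasses,
    Nat.card_eq_fintype_card, Nat.card_eq_fintype_card, Nat.card_eq_fintype_card,
    MulAction.card_orbit_mul_card_stabilizer_eq_card_group]
  rfl

variable [Finite G]

theorem card_carrier_ne_zero (K : ConjClasses G) : Nat.card K.carrier ≠ 0 := by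
  obtain ⟨g, rfl⟩ := ConjClasses.exists_rep K
  intro h
  have := card_carrier_mul_card_centralizer g
  rw [h, zero_mul] at this
  exact Nat.card_pos.ne this

theorem cent_mul_prod_card [Fintype (ConjClasses G)] :
    cent G * ∏ K : ConjClasses G, (Nat.card K.carrier : ℝ) =
      ∏ _K : ConjClasses G, (Nat.card G : ℝ) := by
  rw [cent, finprod_eq_prod_of_fintype, ← Finset.prod_mul_distrib]
  refine Finset.prod_congr rfl fun K _ => ?_
  have h := card_carrier_mul_card_centralizer (Quotient.out K : G)
  rw [show ConjClasses.mk (Quotient.out K : G) = K from Quotient.out_eq K] at h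
  rw [mul_comm]
  exact_mod_cast h

theorem gram_eq {ι : Type*} [Fintype ι] [DecidableEq ι] (v : ι → Subalgebra.center ℂ ℂ[G]) :
    gram v = ‖(Matrix.of fun i j => form (v i) (v j)).det‖ := by
  unfold gram
  convert rfl

/-- The class sums form a basis of the center of the group algebra. -/
def classSumBasis [Fintype (ConjClasses G)] :
    Module.Basis (ConjClasses G) ℂ (Subalgebra.center ℂ ℂ[G]) :=
  Module.Basis.ofEquivFun
    { toFun := fun u K => (u : ℂ[G]).coeff (Quotient.out K)
      map_add' := fun _ _ => rfl
      map_smul' := fun _ _ => rfl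
      invFun := fun f => ∑ K, f K • classSum K
      left_inv := fun u => (center_eq_sum u).symm
      right_inv := fun f => by
        classical
        ext K
        simp only [AddSubmonoidClass.coe_finsetSum, SetLike.val_smul, MonoidAlgebra.coeff_sum,
          Finsupp.finsetSum_apply, MonoidAlgebra.coeff_smul, Finsupp.smul_apply, coeff_classSum]
        rw [show ConjClasses.mk (Quotient.out K : G) = K from Quotient.out_eq K]
        simp }

/-- In the Wedderburn coordinates of the class sums the trace form factors as A B and |G| times
`coeffForm` as A D B, with D the diagonal matrix of the d_i². The latter is diagonal on class sums,
so its determinant is known. -/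
theorem det_form_classSum_mul {ι : Type*} [Fintype ι] {d : ι → ℕ} [∀ i, NeZero (d i)]
    (e : ℂ[G] ≃ₐ[ℂ] (i : ι) → Matrix (Fin (d i)) (Fin (d i)) ℂ) [Fintype (ConjClasses G)]
    [DecidableEq (ConjClasses G)] :
    (Matrix.of fun K L : ConjClasses G => form (classSum K) (classSum L)).det *
        ∏ i, (d i : ℂ) ^ 2 =
      ∏ K : ConjClasses G, ((Nat.card G : ℂ) * Nat.card K.carrier) := by
  have hcard : Fintype.card (ConjClasses G) = Fintype.card ι := by
    rw [← Module.finrank_eq_card_basis (classSumBasis (G := G)),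
      ← (centerEquiv e).toLinearEquiv.finrank_eq, Module.finrank_fintype_fun_eq_card]
  -- Blocks are reindexed by classes so that A and B are square matrices over one index type.
  let σ := Fintype.equivOfCardEq hcard
  let A : Matrix (ConjClasses G) (ConjClasses G) ℂ := Matrix.of fun K L =>
    (centerEquiv e).symm (barCenter (classSum K)) (σ L)
  let B : Matrix (ConjClasses G) (ConjClasses G) ℂ := Matrix.of fun L K =>
    (centerEquiv e).symm (classSum K) (σ L)
  have h1 : (Matrix.of fun K L : ConjClasses G => form (classSum K) (classSum L)) = A * B := by
    ext K L
    rw [Matrix.mul_apply, Matrix.of_apply, form_eq,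
      ← (centerEquiv e).apply_symm_apply (barCenter (classSum K) * classSum L),
      trace_centerEquiv, map_mul]
    exact (Equiv.sum_comp σ _).symm
  have h2 : Matrix.diagonal (fun K : ConjClasses G => (Nat.card G : ℂ) * Nat.card K.carrier) =
      A * Matrix.diagonal (fun L => (d (σ L) : ℂ) ^ 2) * B := by
    ext K L
    have h3 : (Nat.card G : ℂ) * coeffForm (classSum K) (classSum L) =
        ∑ M, A K M * (d (σ M) : ℂ) ^ 2 * B M L := by
      rw [coeffForm, ← (centerEquiv e).apply_symm_apply (barCenter (classSum K) * classSum L),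
        card_mul_coeff_one_centerEquiv, map_mul, ← Equiv.sum_comp σ]
      refine Finset.sum_congr rfl fun M _ => ?_
      simp only [A, B, Matrix.of_apply, Pi.mul_apply]
      ring
    rw [Matrix.mul_apply]
    simp only [Matrix.mul_diagonal]
    rw [← h3, coeffForm_classSum, Matrix.diagonal_apply, mul_ite, mul_zero]
  have h3 := congrArg Matrix.det h2
  rw [Matrix.det_mul, Matrix.det_mul, Matrix.det_diagonal, Matrix.det_diagonal,
    Equiv.prod_comp σ (fun i => (d i : ℂ) ^ 2)] at h3
  rw [h1, h3, Matrix.det_mul]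
  ring

/-- The witness is kept real and nonnegative so that square roots can be taken in the main theorem.
-/
theorem exists_harada_sq (G : Type*) [Group G] [Finite G] :
    ∃ r : ℝ, 0 ≤ r ∧ harada G = r ∧ mu G = r ^ 2 := by
  classical
  obtain ⟨n, d, hd, ⟨e⟩⟩ :=
    IsSemisimpleRing.exists_algEquiv_pi_matrix_of_isAlgClosed ℂ ℂ[G]
  have := Fintype.ofFinite (ConjClasses G)
  refine ⟨(∏ K : ConjClasses G, (Nat.card K.carrier : ℝ)) / ∏ i, (d i : ℝ), by positivity, ?_, ?_⟩
  · rw [harada, finprod_Irr e, finprod_eq_prod_of_fintype]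
    push_cast
    rfl
  · have h := congrArg norm (det_form_classSum_mul e)
    have hd0 : ∏ i, (d i : ℝ) ≠ 0 := Finset.prod_ne_zero_iff.2 fun i _ => by
      exact_mod_cast NeZero.ne (d i)
    have hK : ∏ K : ConjClasses G, (Nat.card K.carrier : ℝ) ≠ 0 :=
      Finset.prod_ne_zero_iff.2 fun K _ => by exact_mod_cast card_carrier_ne_zero K
    have hc := cent_mul_prod_card (G := G)
    have hG : ∏ _K : ConjClasses G, (Nat.card G : ℝ) ≠ 0 :=
      Finset.prod_ne_zero_iff.2 fun K _ => by exact_mod_cast Nat.card_pos.ne'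
    have hc0 : cent G ≠ 0 := fun h0 => hG (by rw [← hc, h0, zero_mul])
    rw [norm_mul, ← gram_eq] at h
    simp only [norm_prod, norm_pow, norm_mul, RCLike.norm_natCast, Finset.prod_mul_distrib,
      Finset.prod_pow] at h
    change gamma G * _ = _ at h
    rw [← hc] at h
    rw [mu]
    field_simp
    rw [h]
    ring

/-- The coordinates of a family of central elements in the basis of class sums. -/
def coordMatrix {ι : Type*} (v : ι → Subalgebra.center ℂ ℂ[G]) : Matrix ι (ConjClasses G) ℂ :=
  Matrix.of fun i K => (v i : ℂ[G]).coeff (Quotient.out K)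

/-- An arbitrary functional `l` is allowed so that the trace and the coefficient of 1 receive the
same factor |det P|². -/
theorem norm_det_change_basis {ι : Type*} [Fintype ι] [DecidableEq ι] [Fintype (ConjClasses G)]
    [DecidableEq (ConjClasses G)] (σ : ConjClasses G ≃ ι)
    (l : Subalgebra.center ℂ ℂ[G] →ₗ[ℂ] ℂ) (v : ι → Subalgebra.center ℂ ℂ[G]) :
    ‖(Matrix.of fun i j => l (barCenter (v i) * v j)).det‖ =
      ‖((coordMatrix v).submatrix σ id).det‖ ^ 2 *
        ‖(Matrix.of fun K L : ConjClasses G => l (barCenter (classSum K) * classSum L)).det‖ := by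
  set P := (coordMatrix v).submatrix σ id with hP
  have h : (Matrix.of fun i j => l (barCenter (v i) * v j)).submatrix σ σ =
      P.map (starRingEnd ℂ) *
        (Matrix.of fun K L : ConjClasses G => l (barCenter (classSum K) * classSum L)) *
          P.transpose := by
    ext K L
    rw [Matrix.submatrix_apply, Matrix.of_apply, center_eq_sum (v (σ K)), center_eq_sum (v (σ L))]
    simp only [map_sum, Finset.sum_mul, Finset.mul_sum, LinearMap.map_smulₛₗ, smul_mul_assoc,
      mul_smul_comm, map_smul, Matrix.mul_apply, smul_eq_mul]
    refine Finset.sum_congr rfl fun M _ => Finset.sum_congr rfl fun N _ => ?_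
    simp only [hP, coordMatrix, Matrix.map_apply, Matrix.submatrix_apply, Matrix.of_apply, id,
      Matrix.transpose_apply]
    ring
  rw [← Matrix.det_submatrix_equiv_self σ, h, Matrix.det_mul, Matrix.det_mul,
    Matrix.det_transpose, ← RingHom.mapMatrix_apply, ← RingHom.map_det, norm_mul, norm_mul,
    RCLike.norm_conj]
  ring

/-- The coefficient of `1`, as a linear functional on the center. -/
def coeffOne (G : Type*) [Group G] : Subalgebra.center ℂ ℂ[G] →ₗ[ℂ] ℂ where
  toFun u := (u : ℂ[G]).coeff 1
  map_add' _ _ := rfl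
  map_smul' _ _ := rfl

/-- The factor |det P|² is common to both forms. This reduces the Gramian of `v` to its `coeffForm`
determinant; `v` need not be known to be a basis, and `σ` only matches the number of members. -/
theorem gram_mul_prod_card {ι : Type*} [Fintype ι] [DecidableEq ι] [Fintype (ConjClasses G)]
    (σ : ConjClasses G ≃ ι) (v : ι → Subalgebra.center ℂ ℂ[G]) :
    gram v * ∏ K : ConjClasses G, (Nat.card K.carrier : ℝ) =
      ‖(Matrix.of fun i j => coeffForm (v i) (v j)).det‖ * gamma G := by
  classical
  have h1 := norm_det_change_basis σ (Algebra.trace ℂ _) v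
  have h2 := norm_det_change_basis σ (coeffOne G) v
  have h3 : (Matrix.of fun K L : ConjClasses G =>
      coeffOne G (barCenter (classSum K) * classSum L)) =
        Matrix.diagonal fun K : ConjClasses G => (Nat.card K.carrier : ℂ) := by
    ext K L
    rw [Matrix.diagonal_apply, ← coeffForm_classSum]
    rfl
  rw [h3, Matrix.det_diagonal, norm_prod] at h2
  simp only [RCLike.norm_natCast] at h2
  rw [gamma, gram_eq, gram_eq]
  refine (congrArg (· * _) h1).trans (Eq.trans ?_ (congrArg (· * _) h2).symm)
  simp only [form_eq]
  ring

end Gram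

/-! ### Characters of Z and their orthogonal idempotents -/

section Idempotents

variable {G : Type*} [Group G] {Z : Subgroup G}

/-- Irreducible representations of a commutative group are one-dimensional, so the character is the
single matrix entry and is multiplicative. -/
theorem exists_monoidHom_of_mem_Irr {A : Type*} [Group A] [IsMulCommutative A] {φ : A → ℂ}
    (hφ : φ ∈ Irr A) : ∃ ψ : A →* ℂ, φ = ψ := by
  obtain ⟨n, ρ, hρ, rfl⟩ := hφ
  have h1 := Representation.IsIrreducible.finrank_eq_one_of_isMulCommutative ρ
  rw [Module.finrank_fintype_fun_eq_card, Fintype.card_fin] at h1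
  subst h1
  refine ⟨{ toFun := ρ.character, map_one' := by simp, map_mul' := fun x y => ?_ }, rfl⟩
  have h : ∀ x, ρ.character x =
      LinearMap.toMatrix (Pi.basisFun ℂ (Fin 1)) (Pi.basisFun ℂ (Fin 1)) (ρ x) 0 0 := fun x => by
    rw [Representation.character, LinearMap.trace_eq_matrix_trace ℂ (Pi.basisFun ℂ (Fin 1)),
      Matrix.trace, Fin.sum_univ_one, Matrix.diag_apply]
  rw [h, h, h, map_mul, LinearMap.toMatrix_mul, Matrix.mul_apply, Fin.sum_univ_one]

theorem conj_hom_apply {A : Type*} [Group A] [Finite A] (χ : A →* ℂ) (a : A) :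
    conj (χ a) = χ a⁻¹ := by
  have h1 : ‖χ a‖ = 1 := by
    refine Complex.norm_eq_one_of_pow_eq_one (n := Nat.card A) ?_ Nat.card_pos.ne'
    rw [← map_pow, pow_card_eq_one', map_one]
  have h2 : χ a⁻¹ * χ a = 1 := by rw [← map_mul, inv_mul_cancel, map_one]
  rw [← Complex.inv_eq_conj h1]
  exact (eq_inv_of_mul_eq_one_left h2).symm

variable [Finite G]

omit [Finite G] in
theorem idemAux_eq_sum [Fintype Z] (φ : Z → ℂ) :
    idemAux φ = (Nat.card Z : ℂ)⁻¹ • ∑ z : Z, MonoidAlgebra.single (z : G) (conj (φ z)) := by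
  rw [idemAux, finsum_eq_sum_of_fintype]

omit [Finite G] in
theorem coeff_idemAux_mul [Fintype Z] (φ : Z → ℂ) (u : ℂ[G]) (x : G) :
    (idemAux φ * u).coeff x =
      (Nat.card Z : ℂ)⁻¹ * ∑ z : Z, conj (φ z) * u.coeff ((z : G)⁻¹ * x) := by
  rw [idemAux_eq_sum, smul_mul_assoc, Finset.sum_mul]
  simp [MonoidAlgebra.coeff_sum]

theorem single_mul_idemAux (χ : Z →* ℂ) (z : Z) :
    MonoidAlgebra.single (z : G) 1 * idemAux χ = χ z • idemAux (χ : Z → ℂ) := by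
  have := Fintype.ofFinite Z
  rw [idemAux_eq_sum, mul_smul_comm, smul_comm (χ z), Finset.mul_sum]
  refine congrArg (fun u : ℂ[G] => (Nat.card Z : ℂ)⁻¹ • u) ?_
  rw [Finset.smul_sum]
  refine Fintype.sum_equiv (Equiv.mulLeft z) _ _ fun y => ?_
  have h : χ z * χ z⁻¹ = 1 := by rw [← map_mul, mul_inv_cancel, map_one]
  simp only [MonoidAlgebra.single_mul_single, one_mul, Equiv.coe_mulLeft, Subgroup.coe_mul,
    MonoidAlgebra.smul_single, smul_eq_mul, map_mul, conj_hom_apply χ z, ← mul_assoc, h]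

theorem idem_mul_idem (hZ : Z ≤ Subgroup.center G) (χ ψ : Z →* ℂ) [Decidable (χ = ψ)] :
    idem hZ χ * idem hZ ψ = if χ = ψ then idem hZ ψ else 0 := by
  classical
  have := Fintype.ofFinite Z
  have h1 : ∑ z : Z, χ z⁻¹ * ψ z = if χ = ψ then (Nat.card Z : ℂ) else 0 := by
    split_ifs with h
    · subst h
      rw [Finset.sum_congr rfl fun z _ => by rw [← map_mul, inv_mul_cancel, map_one]]
      simp
    · have : IsMulCommutative Z := ⟨⟨fun a b => Subtype.ext (Subgroup.mem_center_iff.1 (hZ b.2) a)⟩⟩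
      let f : Z →* ℂ :=
        { toFun := fun z => χ z⁻¹ * ψ z
          map_one' := by simp
          map_mul' := fun a b => by
            simp only [mul_inv_rev, map_mul]
            ring }
      refine sum_hom_units_eq_zero f fun hf => h (MonoidHom.ext fun z => ?_)
      have h2 : χ z⁻¹ * ψ z = 1 := DFunLike.congr_fun hf z
      have h3 : χ z⁻¹ * χ z = 1 := by rw [← map_mul, inv_mul_cancel, map_one]
      exact mul_left_cancel₀ (left_ne_zero_of_mul_eq_one h3) (h3.trans h2.symm)
  refine Subtype.ext ?_
  change idemAux χ * idemAux ψ = _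
  rw [idemAux_eq_sum (χ : Z → ℂ), smul_mul_assoc, Finset.sum_mul]
  have h2 : ∀ z : Z, MonoidAlgebra.single (z : G) (conj (χ z)) * idemAux (ψ : Z → ℂ) =
      (χ z⁻¹ * ψ z) • idemAux (ψ : Z → ℂ) := fun z => by
    rw [mul_smul, ← single_mul_idemAux, ← smul_mul_assoc, MonoidAlgebra.smul_single, conj_hom_apply,
      smul_eq_mul, mul_one]
  rw [Finset.sum_congr rfl fun z _ => h2 z, ← Finset.sum_smul, h1, smul_smul]
  have hc : (Nat.card Z : ℂ) ≠ 0 := by exact_mod_cast Nat.card_pos.ne'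
  split_ifs with h
  · rw [inv_mul_cancel₀ hc, one_smul]
    rfl
  · simp

theorem bar_single (x : G) (c : ℂ) :
    bar (MonoidAlgebra.single x c) = MonoidAlgebra.single x⁻¹ (conj c) := by
  classical
  ext y
  rw [coeff_bar, MonoidAlgebra.coeff_single, MonoidAlgebra.coeff_single, Finsupp.single_apply,
    Finsupp.single_apply, inv_eq_iff_eq_inv]
  split_ifs <;> simp

theorem barCenter_idem (hZ : Z ≤ Subgroup.center G) (χ : Z →* ℂ) :
    barCenter (idem hZ χ) = idem hZ χ := by
  have := Fintype.ofFinite Z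
  refine Subtype.ext ?_
  change bar (idemAux χ) = idemAux χ
  let b : ℂ[G] →+ ℂ[G] :=
    { toFun := bar, map_zero' := by simpa using bar_smul 0 (0 : ℂ[G]), map_add' := bar_add }
  rw [idemAux_eq_sum, bar_smul]
  refine congrArg₂ (· • ·) (by simp) ((map_sum b _ _).trans ?_)
  refine Fintype.sum_equiv (Equiv.inv Z) _ _ fun z => ?_
  change bar _ = _
  rw [bar_single, Complex.conj_conj, Equiv.inv_apply, conj_hom_apply, inv_inv]
  rfl

theorem barCenter_idem_mul_mul (hZ : Z ≤ Subgroup.center G) (χ ψ : Z →* ℂ) [Decidable (χ = ψ)]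
    (u v : Subalgebra.center ℂ ℂ[G]) :
    barCenter (idem hZ χ * u) * (idem hZ ψ * v) =
      if χ = ψ then barCenter u * (idem hZ ψ * v) else 0 := by
  rw [barCenter_mul, barCenter_idem, mul_mul_mul_comm, idem_mul_idem]
  split_ifs
  · ring
  · rw [zero_mul]

end Idempotents

/-! ### The action of Z on conjugacy classes -/

section Annihilators

variable {G : Type*} [Group G] {Z : Subgroup G}

theorem smul_carrier_mk (hZ : Z ≤ Subgroup.center G) (z : Z) (x : G) :
    z • (ConjClasses.mk x).carrier = (ConjClasses.mk ((z : G) * x)).carrier := by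
  have hz : ∀ c : G, c * z = z * c := fun c => Subgroup.mem_center_iff.1 (hZ z.2) c
  ext y
  rw [Set.mem_smul_set_iff_inv_smul_mem, ConjClasses.mem_carrier_iff_mk_eq,
    ConjClasses.mem_carrier_iff_mk_eq, ConjClasses.mk_eq_mk_iff_isConj,
    ConjClasses.mk_eq_mk_iff_isConj, isConj_iff, isConj_iff]
  refine exists_congr fun c => ?_
  change c * ((z : G)⁻¹ * y) * c⁻¹ = x ↔ _
  have h : c * ((z : G)⁻¹ * y) * c⁻¹ = (z : G)⁻¹ * (c * y * c⁻¹) := by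
    have h' : c * (z : G)⁻¹ = (z : G)⁻¹ * c := by
      rw [mul_inv_eq_iff_eq_mul, mul_assoc, hz, inv_mul_cancel_left]
    rw [← mul_assoc, h']
    group
  rw [h, inv_mul_eq_iff_eq_mul]

theorem mk_inv_mul_eq_iff (hZ : Z ≤ Subgroup.center G) (K : ConjClasses G) {x : G}
    (hx : x ∈ K.carrier) (z : Z) :
    ConjClasses.mk ((z : G)⁻¹ * x) = K ↔ z ∈ ann Z K := by
  rw [ConjClasses.mem_carrier_iff_mk_eq] at hx
  subst hx
  rw [ann, ← inv_mem_iff, MulAction.mem_stabilizer_iff, smul_carrier_mk hZ]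
  refine ⟨fun h => by rw [← h]; rfl, fun h => ?_⟩
  rw [← ConjClasses.mem_carrier_iff_mk_eq, ← h, ConjClasses.mem_carrier_iff_mk_eq]
  rfl

theorem card_carrier_mk_mul (hZ : Z ≤ Subgroup.center G) (z : Z) (x : G) :
    Nat.card (ConjClasses.mk ((z : G) * x)).carrier = Nat.card (ConjClasses.mk x).carrier := by
  rw [← smul_carrier_mk hZ]
  exact Set.ncard_smul_set z _

variable [Z.Normal]

/-- The conjugacy class of `G/Z` below a conjugacy class of `G`. -/
def quotClass (Z : Subgroup G) [Z.Normal] (K : ConjClasses G) : ConjClasses (G ⧸ Z) :=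
  ConjClasses.map (QuotientGroup.mk' Z) K

theorem quotClass_mk (x : G) :
    quotClass Z (ConjClasses.mk x) = ConjClasses.mk (QuotientGroup.mk x : G ⧸ Z) := rfl

theorem quotClass_mk_mul (z : Z) (x : G) :
    quotClass Z (ConjClasses.mk ((z : G) * x)) = quotClass Z (ConjClasses.mk x) := by
  rw [quotClass_mk, quotClass_mk, QuotientGroup.mk_mul, (QuotientGroup.eq_one_iff _).2 z.2, one_mul]

theorem quotClass_mk_inv_mul (z : Z) (x : G) :
    quotClass Z (ConjClasses.mk ((z : G)⁻¹ * x)) = quotClass Z (ConjClasses.mk x) :=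
  quotClass_mk_mul z⁻¹ x

theorem exists_eq_mk_mul (hZ : Z ≤ Subgroup.center G) (K : ConjClasses G) (x : G)
    (h : quotClass Z K = ConjClasses.mk (QuotientGroup.mk x : G ⧸ Z)) :
    ∃ z : Z, K = ConjClasses.mk ((z : G) * x) := by
  obtain ⟨y, rfl⟩ := ConjClasses.exists_rep K
  rw [quotClass_mk, ConjClasses.mk_eq_mk_iff_isConj, isConj_comm, isConj_iff] at h
  obtain ⟨c, hc⟩ := h
  obtain ⟨c, rfl⟩ := QuotientGroup.mk_surjective c
  have h1 : (QuotientGroup.mk (c * x * c⁻¹) : G ⧸ Z) = QuotientGroup.mk y := hc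
  rw [QuotientGroup.eq] at h1
  refine ⟨⟨_, h1⟩, ?_⟩
  rw [ConjClasses.mk_eq_mk_iff_isConj, isConj_comm, isConj_iff]
  refine ⟨c, ?_⟩
  have h2 := Subgroup.mem_center_iff.1 (hZ h1)
  change c * (((c * x * c⁻¹)⁻¹ * y) * x) * c⁻¹ = y
  rw [← mul_assoc, h2 c, mul_assoc, mul_assoc, ← mul_assoc c x, ← h2]
  group

/-- Since Z is central, the classes over a given class of G/Z form one orbit under translation by Z,
with stabilizer Ann; this is the orbit-stabilizer theorem. -/
theorem card_fiber_mul_card_ann [Finite G] (hZ : Z ≤ Subgroup.center G) (x : G) :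
    Nat.card {K : ConjClasses G // quotClass Z K = ConjClasses.mk (QuotientGroup.mk x : G ⧸ Z)} *
      Nat.card (ann Z (ConjClasses.mk x)) = Nat.card Z := by
  have h := Nat.card_congr (MulAction.orbitProdStabilizerEquivGroup Z (ConjClasses.mk x).carrier)
  rw [Nat.card_prod] at h
  rw [← h]
  refine congrArg (· * _) (Nat.card_congr (Equiv.ofBijective (fun K => ⟨K.1.carrier, ?_⟩) ⟨?_, ?_⟩))
  · obtain ⟨z, hz⟩ := exists_eq_mk_mul hZ K.1 x K.2
    exact ⟨z, by rw [hz]; exact smul_carrier_mk hZ z x⟩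
  · rintro ⟨K, hK⟩ ⟨L, hL⟩ hKL
    have h1 : K.carrier = L.carrier := congrArg Subtype.val hKL
    refine Subtype.ext ?_
    obtain ⟨y, rfl⟩ := ConjClasses.exists_rep K
    rw [← ConjClasses.mem_carrier_iff_mk_eq, ← h1]
    exact ConjClasses.mem_carrier_mk
  · rintro ⟨_, z, rfl⟩
    exact ⟨⟨ConjClasses.mk ((z : G) * x), quotClass_mk_mul z x⟩,
      Subtype.ext (smul_carrier_mk hZ z x).symm⟩

end Annihilators

/-! ### The family e_χ[K_j] and multiplicativity of μ -/

section Blocks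

variable {G : Type*} [Group G] {Z : Subgroup G} [Finite G]

theorem sum_mul_coeff_classSum [Fintype Z] (hZ : Z ≤ Subgroup.center G) {K : ConjClasses G} {x : G}
    (hx : x ∈ K.carrier) (f : Z → ℂ) (hf : ∀ z ∈ ann Z K, f z = 1) :
    ∑ z : Z, f z * (classSum K : ℂ[G]).coeff ((z : G)⁻¹ * x) = Nat.card (ann Z K) := by
  classical
  simp only [coeff_classSum, mk_inv_mul_eq_iff hZ K hx, mul_ite, mul_one, mul_zero]
  rw [← Finset.sum_filter, Finset.sum_congr rfl fun z hz => hf z (Finset.mem_filter.1 hz).2]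
  rw [Finset.sum_const, nsmul_one, Nat.card_eq_fintype_card, Fintype.card_subtype]

/-- At a point of K only the z in Ann(K) contribute to the average over Z, and there χ is 1. -/
theorem coeff_idem_mul_classSum (hZ : Z ≤ Subgroup.center G) (χ : Z →* ℂ) {K : ConjClasses G}
    (hK : (ann Z K : Set Z) ⊆ charKer χ) {x : G} (hx : x ∈ K.carrier) :
    ((idem hZ χ * classSum K : Subalgebra.center ℂ ℂ[G]) : ℂ[G]).coeff x =
      Nat.card (ann Z K) / Nat.card Z := by
  have := Fintype.ofFinite Z
  refine (coeff_idemAux_mul _ _ _).trans ?_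
  rw [sum_mul_coeff_classSum hZ hx _ fun z hz => ?_]
  · ring
  · have h : χ z = χ 1 := hK hz
    rw [h, map_one, map_one]

variable [Z.Normal]

theorem coeff_idem_mul_classSum_of_ne (hZ : Z ≤ Subgroup.center G) (χ : Z →* ℂ) {K : ConjClasses G}
    {x : G} (hx : quotClass Z (ConjClasses.mk x) ≠ quotClass Z K) :
    ((idem hZ χ * classSum K : Subalgebra.center ℂ ℂ[G]) : ℂ[G]).coeff x = 0 := by
  classical
  have := Fintype.ofFinite Z
  refine (coeff_idemAux_mul _ _ _).trans ?_
  refine mul_eq_zero_of_right _ (Finset.sum_eq_zero fun z _ => mul_eq_zero_of_right _ ?_)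
  change (classSum K : ℂ[G]).coeff _ = 0
  rw [coeff_classSum, if_neg]
  rintro h
  exact hx (by rw [← h, quotClass_mk_inv_mul])

omit [Z.Normal] in
theorem coeffForm_classSum_idem_mul (hZ : Z ≤ Subgroup.center G) (χ : Z →* ℂ) {K : ConjClasses G}
    (hK : (ann Z K : Set Z) ⊆ charKer χ) :
    coeffForm (classSum K) (idem hZ χ * classSum K) =
      Nat.card K.carrier * (Nat.card (ann Z K) / Nat.card Z) := by
  classical
  have := Fintype.ofFinite G
  rw [coeffForm_eq_sum, ← sum_coeff_classSum K _ _ fun x hx => coeff_idem_mul_classSum hZ χ hK hx]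
  refine Finset.sum_congr rfl fun x _ => ?_
  rw [coeff_classSum K x]
  split_ifs <;> simp

theorem coeffForm_classSum_idem_mul_of_ne (hZ : Z ≤ Subgroup.center G) (χ : Z →* ℂ)
    {K L : ConjClasses G} (h : quotClass Z K ≠ quotClass Z L) :
    coeffForm (classSum K) (idem hZ χ * classSum L) = 0 := by
  classical
  have := Fintype.ofFinite G
  rw [coeffForm_eq_sum]
  refine Finset.sum_eq_zero fun x _ => ?_
  rw [coeff_classSum K x]
  split_ifs with hx
  · subst hx
    rw [coeff_idem_mul_classSum_of_ne hZ χ h, mul_zero]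
  · simp

omit [Finite G] in
theorem mem_basisIdx (g : ConjClasses (G ⧸ Z) → G) (φ : Z → ℂ) (j : ConjClasses (G ⧸ Z)) :
    j ∈ basisIdx g φ ↔ (ann Z (ConjClasses.mk (g j)) : Set Z) ⊆ charKer φ :=
  ⟨fun ⟨_, hX, hj⟩ => by rw [show ann Z (ConjClasses.mk (g j)) = _ from hj]; exact hX,
    fun h => ⟨_, h, rfl⟩⟩

theorem centChar_eq (g : ConjClasses (G ⧸ Z) → G) (φ : Z → ℂ) [Fintype (basisIdx g φ)] :
    centChar g φ = ∏ j : basisIdx g φ, (Nat.card (Subgroup.centralizer {g j}) : ℝ) *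
      (Nat.card (ann Z (ConjClasses.mk (g j))) / Nat.card Z) := by
  have h0 : ∀ N : Subgroup Z, ∀ j ∈ idx g N,
      (Nat.card (Subgroup.centralizer {g j}) : ℝ) / (Nat.card (Z ⧸ N) : ℝ) =
        (Nat.card (Subgroup.centralizer {g j}) : ℝ) *
          (Nat.card (ann Z (ConjClasses.mk (g j))) / Nat.card Z) := by
    intro N j hj
    rw [show ann Z (ConjClasses.mk (g j)) = N from hj,
      Subgroup.card_eq_card_quotient_mul_card_subgroup N]
    have h1 : (Nat.card N : ℝ) ≠ 0 := by exact_mod_cast Nat.card_pos.ne'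
    have h2 : (Nat.card (Z ⧸ N) : ℝ) ≠ 0 := by exact_mod_cast Nat.card_pos.ne'
    push_cast
    field_simp
  have h1 : basisIdx g φ = ⋃ N ∈ {N : Subgroup Z | (N : Set Z) ⊆ charKer φ}, idx g N := by
    ext j
    simp [basisIdx]
  have h2 : {N : Subgroup Z | (N : Set Z) ⊆ charKer φ}.PairwiseDisjoint (idx g) := by
    intro N _ M _ hNM
    refine Set.disjoint_left.2 fun j hj hj' => hNM ?_
    exact (show ann Z _ = N from hj).symm.trans hj'
  rw [← finprod_eq_prod_of_fintype, finprod_set_coe_eq_finprod_mem (basisIdx g φ)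
    (f := fun j => (Nat.card (Subgroup.centralizer {g j}) : ℝ) *
      (Nat.card (ann Z (ConjClasses.mk (g j))) / Nat.card Z)), h1,
    finprod_mem_biUnion h2 (Set.toFinite _) fun N _ => Set.toFinite _, centChar]
  exact finprod_congr fun N => finprod_congr fun _ => finprod_mem_congr rfl (h0 N)

theorem gram_reindex {ι κ : Type*} [Finite ι] [Finite κ] (σ : ι ≃ κ)
    (v : κ → Subalgebra.center ℂ ℂ[G]) : gram (v ∘ σ) = gram v := by
  classical
  have := Fintype.ofFinite ι
  have := Fintype.ofFinite κ
  rw [gram_eq, gram_eq, ← Matrix.det_submatrix_equiv_self σ]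
  rfl

/-- The basis of the center that is the union of the bases `e_χ [K_j]`. -/
def blockBasis {ι : Type*} (hZ : Z ≤ Subgroup.center G) (g : ConjClasses (G ⧸ Z) → G)
    (χ : ι → Z →* ℂ) (s : Σ a, basisIdx g (χ a)) : Subalgebra.center ℂ ℂ[G] :=
  idem hZ (χ s.1) * classSum (ConjClasses.mk (g s.2))

/-- As `bar` fixes each e_χ and distinct ones multiply to 0, the Gram matrix is block diagonal. The
order on ι lets this be used as block triangularity. -/
theorem gram_blockBasis {ι : Type*} [Fintype ι] [LinearOrder ι] (hZ : Z ≤ Subgroup.center G)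
    (g : ConjClasses (G ⧸ Z) → G) (χ : ι → Z →* ℂ) (hχ : Function.Injective χ) :
    gram (blockBasis hZ g χ) = ∏ a, gammaChar hZ g (χ a) := by
  classical
  have := fun a => Fintype.ofFinite (basisIdx g (χ a))
  have h : (Matrix.of fun s t => form (blockBasis hZ g χ s) (blockBasis hZ g χ t)).BlockTriangular
      Sigma.fst := by
    intro s t hst
    rw [Matrix.of_apply, form_eq, blockBasis, blockBasis, barCenter_idem_mul_mul,
      if_neg fun h => hst.ne (hχ h).symm, map_zero]
  rw [gram_eq, h.det_fintype, norm_prod]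
  refine Finset.prod_congr rfl fun a _ => ?_
  rw [gammaChar, gram_eq, ← Matrix.det_submatrix_equiv_self (Equiv.sigmaSubtype a).symm]
  rfl

/-- Entries with different χ vanish by orthogonality of the idempotents; those with equal χ and
different j vanish because e_χ[K_j] is supported over j. -/
theorem det_coeffForm_blockBasis {ι : Type*} [Fintype ι] [DecidableEq ι]
    (hZ : Z ≤ Subgroup.center G)
    (g : ConjClasses (G ⧸ Z) → G)
    (hg : ∀ j, ConjClasses.mk (QuotientGroup.mk (g j) : G ⧸ Z) = j)
    (χ : ι → Z →* ℂ) (hχ : Function.Injective χ) [∀ a, Fintype (basisIdx g (χ a))]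
    [DecidableEq (Σ a, basisIdx g (χ a))] :
    (Matrix.of fun s t => coeffForm (blockBasis hZ g χ s) (blockBasis hZ g χ t)).det =
      ∏ s : Σ a, basisIdx g (χ a), ((Nat.card (ConjClasses.mk (g s.2)).carrier : ℂ) *
        (Nat.card (ann Z (ConjClasses.mk (g s.2))) / Nat.card Z)) := by
  classical
  rw [← Matrix.det_diagonal]
  congr 1
  ext s t
  rw [Matrix.of_apply, Matrix.diagonal_apply, coeffForm, blockBasis, blockBasis,
    barCenter_idem_mul_mul]
  obtain ⟨a, i⟩ := s
  obtain ⟨b, j⟩ := t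
  by_cases hab : a = b
  · subst hab
    rw [if_pos rfl]
    by_cases hij : i = j
    · subst hij
      rw [if_pos rfl]
      exact coeffForm_classSum_idem_mul hZ _ ((mem_basisIdx _ _ _).1 i.2)
    · rw [if_neg fun h => hij (by simpa using h)]
      refine coeffForm_classSum_idem_mul_of_ne hZ _ fun h => hij (Subtype.ext ?_)
      rwa [quotClass_mk, quotClass_mk, hg, hg] at h
  · rw [if_neg fun h => hab (hχ h), if_neg fun h => hab (congrArg Sigma.fst h)]
    rfl

theorem mu_eq_prod_muChar {ι : Type*} [Fintype ι] [LinearOrder ι]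
    (hZ : Z ≤ Subgroup.center G) (g : ConjClasses (G ⧸ Z) → G)
    (hg : ∀ j, ConjClasses.mk (QuotientGroup.mk (g j) : G ⧸ Z) = j)
    (χ : ι → Z →* ℂ) (hχ : Function.Injective χ)
    (σ : ConjClasses G ≃ Σ a, basisIdx g (χ a))
    (hσ : ∀ K, Nat.card K.carrier = Nat.card (ConjClasses.mk (g (σ K).2)).carrier) :
    mu G = ∏ a, muChar hZ g (χ a) := by
  classical
  have := fun a => Fintype.ofFinite (basisIdx g (χ a))
  have := Fintype.ofFinite (ConjClasses G)
  have h1 := gram_mul_prod_card σ (blockBasis hZ g χ)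
  rw [gram_blockBasis hZ g χ hχ, det_coeffForm_blockBasis hZ g hg χ hχ, norm_prod] at h1
  simp only [norm_mul, norm_div, RCLike.norm_natCast, Finset.prod_mul_distrib] at h1
  have hprod : ∏ K : ConjClasses G, (Nat.card K.carrier : ℝ) =
      ∏ s : Σ a, basisIdx g (χ a), (Nat.card (ConjClasses.mk (g s.2)).carrier : ℝ) :=
    Fintype.prod_equiv σ _ _ fun K => by rw [hσ]
  have hK : ∏ s : Σ a, basisIdx g (χ a), (Nat.card (ConjClasses.mk (g s.2)).carrier : ℝ) ≠ 0 :=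
    Finset.prod_ne_zero_iff.2 fun s _ => by exact_mod_cast card_carrier_ne_zero _
  -- Class size times centralizer order is always |G|, so matching class sizes through σ also
  -- matches the centralizer products.
  have hcent : cent G = ∏ s : Σ a, basisIdx g (χ a), (Nat.card (Subgroup.centralizer {g s.2}) : ℝ) := by
    refine mul_right_cancel₀ hK ?_
    rw [← hprod, cent_mul_prod_card, hprod, ← Finset.prod_mul_distrib]
    refine Fintype.prod_equiv σ _ _ fun K => ?_
    rw [← card_carrier_mul_card_centralizer (g (σ K).2), mul_comm]
    push_cast
    rfl
  have hN : ∏ s : Σ a, basisIdx g (χ a),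
      ((Nat.card (ann Z (ConjClasses.mk (g s.2))) : ℝ) / Nat.card Z) ≠ 0 :=
    Finset.prod_ne_zero_iff.2 fun s _ =>
      div_ne_zero (by exact_mod_cast Nat.card_pos.ne') (by exact_mod_cast Nat.card_pos.ne')
  have hcentChar : ∏ a, centChar g (χ a) = cent G * ∏ s : Σ a, basisIdx g (χ a),
      ((Nat.card (ann Z (ConjClasses.mk (g s.2))) : ℝ) / Nat.card Z) := by
    rw [hcent, ← Finset.prod_mul_distrib, Fintype.prod_sigma]
    exact Finset.prod_congr rfl fun a _ => centChar_eq g (χ a)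
  rw [hprod] at h1
  have h2 : ∏ a, gammaChar hZ g (χ a) = gamma G * ∏ s : Σ a, basisIdx g (χ a),
      ((Nat.card (ann Z (ConjClasses.mk (g s.2))) : ℝ) / Nat.card Z) := by
    refine mul_right_cancel₀ hK (h1.trans ?_)
    simp only [Finset.prod_div_distrib]
    ring
  simp only [muChar, Finset.prod_div_distrib]
  rw [h2, hcentChar, mul_div_mul_right _ _ hN, mu]

end Blocks

/-! ### Counting classes and characters when |Z| is prime -/

section PrimeOrder

variable {G : Type*} [Group G] {Z : Subgroup G} [Finite G] [Z.Normal]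

theorem orderOf_eq_of_ne_one {A : Type*} [Group A] {p : ℕ} [Fact p.Prime] (hp : Nat.card A = p)
    {ψ : A →* ℂ} (hψ : ψ ≠ 1) : orderOf ψ = p := by
  refine orderOf_eq_prime (MonoidHom.ext fun z => ?_) hψ
  rw [MonoidHom.pow_apply, ← map_pow, ← hp, pow_card_eq_one', map_one, MonoidHom.one_apply]

theorem pow_fin_injective {A : Type*} [Group A] {p : ℕ} [Fact p.Prime] (hp : Nat.card A = p)
    {ψ : A →* ℂ} (hψ : ψ ≠ 1) : Function.Injective fun a : Fin p => ψ ^ (a : ℕ) := by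
  intro a b hab
  have h := orderOf_eq_of_ne_one hp hψ
  refine Fin.ext (pow_injOn_Iio_orderOf (x := ψ) ?_ ?_ hab)
  · rw [h]; exact a.2
  · rw [h]; exact b.2

omit [Finite G] in
-- Ann is trivial or all of Z. In the first case all p powers of ψ are admissible; in the second
-- only the trivial one, a = 0.
theorem card_basisIdx_mul_card_ann {p : ℕ} [Fact p.Prime] (hp : Nat.card Z = p)
    {ψ : Z →* ℂ} (hψ : ψ ≠ 1) (g : ConjClasses (G ⧸ Z) → G) (j : ConjClasses (G ⧸ Z)) :
    Nat.card {a : Fin p // j ∈ basisIdx g (ψ ^ (a : ℕ) : Z →* ℂ)} *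
      Nat.card (ann Z (ConjClasses.mk (g j))) = p := by
  have : Fact (Nat.card Z).Prime := by rw [hp]; infer_instance
  rcases Subgroup.eq_bot_or_eq_top_of_prime_card (ann Z (ConjClasses.mk (g j))) with h | h
  · have h1 : ∀ a : Fin p, j ∈ basisIdx g (ψ ^ (a : ℕ) : Z →* ℂ) := fun a => by
      rw [mem_basisIdx, h]
      intro z hz
      rw [show z = 1 from hz]
      rfl
    rw [h, Nat.card_congr (Equiv.subtypeUnivEquiv h1)]
    simp
  · have h1 : ∀ a : Fin p, j ∈ basisIdx g (ψ ^ (a : ℕ) : Z →* ℂ) ↔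
        a = (⟨0, (Fact.out : p.Prime).pos⟩ : Fin p) := fun a => by
      rw [mem_basisIdx, h, ← (pow_fin_injective hp hψ).eq_iff]
      constructor
      · intro hz
        refine MonoidHom.ext fun z => ?_
        have h2 : (ψ ^ (a : ℕ)) z = (ψ ^ (a : ℕ)) 1 := hz (Set.mem_univ z)
        simpa using h2
      · intro ha z _
        have h2 : ψ ^ (a : ℕ) = 1 := by simpa using ha
        rw [h2]
        rfl
    rw [h, Nat.card_congr (Equiv.subtypeEquivRight h1)]
    simp [hp]

/-- Over each j both sides have p/|Ann(K_j)| elements, so any bijection of fibers works: every class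
over j is a central translate of K_j and has its size. -/
theorem exists_equiv_sigma_basisIdx {p : ℕ} [Fact p.Prime] (hZ : Z ≤ Subgroup.center G)
    (hp : Nat.card Z = p) {ψ : Z →* ℂ} (hψ : ψ ≠ 1) (g : ConjClasses (G ⧸ Z) → G)
    (hg : ∀ j, ConjClasses.mk (QuotientGroup.mk (g j) : G ⧸ Z) = j) :
    ∃ σ : ConjClasses G ≃ Σ a : Fin p, basisIdx g (ψ ^ (a : ℕ) : Z →* ℂ),
      ∀ K, Nat.card K.carrier = Nat.card (ConjClasses.mk (g (σ K).2)).carrier := by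
  have h1 : ∀ j, Nonempty ({K : ConjClasses G // quotClass Z K = j} ≃
      {a : Fin p // j ∈ basisIdx g (ψ ^ (a : ℕ) : Z →* ℂ)}) := fun j => by
    refine ⟨(Finite.equivFinOfCardEq ?_).trans (Finite.equivFin _).symm⟩
    have h2 := card_fiber_mul_card_ann hZ (g j)
    rw [hg, hp, ← card_basisIdx_mul_card_ann hp hψ g j] at h2
    exact Nat.eq_of_mul_eq_mul_right Nat.card_pos h2
  let e : (Σ j, {a : Fin p // j ∈ basisIdx g (ψ ^ (a : ℕ) : Z →* ℂ)}) ≃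
      Σ a : Fin p, basisIdx g (ψ ^ (a : ℕ) : Z →* ℂ) :=
    { toFun := fun s => ⟨s.2.1, s.1, s.2.2⟩
      invFun := fun s => ⟨s.2.1, s.1, s.2.2⟩
      left_inv := fun _ => rfl
      right_inv := fun _ => rfl }
  refine ⟨(Equiv.sigmaFiberEquiv (quotClass Z)).symm.trans
    ((Equiv.sigmaCongrRight fun j => (h1 j).some).trans e), fun K => ?_⟩
  change _ = Nat.card (ConjClasses.mk (g (quotClass Z K))).carrier
  obtain ⟨z, hz⟩ := exists_eq_mk_mul hZ K (g (quotClass Z K)) (hg _).symm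
  rw [← card_carrier_mk_mul hZ z (g (quotClass Z K)), ← hz]

end PrimeOrder

/-! ### The trivial character and the quotient G/Z -/

section TrivialBlock

variable {G : Type*} [Group G] [Finite G] {Z : Subgroup G} [Z.Normal]

/-- The projection of the group algebra of `G` onto that of `G/Z`. -/
def quotMap (Z : Subgroup G) [Z.Normal] : ℂ[G] →ₐ[ℂ] ℂ[G ⧸ Z] :=
  MonoidAlgebra.mapDomainAlgHom ℂ ℂ (QuotientGroup.mk' Z)

omit [Finite G] in
theorem quotMap_single (x : G) (c : ℂ) :
    quotMap Z (MonoidAlgebra.single x c) = MonoidAlgebra.single (QuotientGroup.mk x) c := by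
  simp [quotMap]

omit [Finite G] in
theorem coeff_quotMap_mk [Fintype Z] (u : ℂ[G]) (y : G) :
    (quotMap Z u).coeff (QuotientGroup.mk y) = ∑ z : Z, u.coeff ((z : G)⁻¹ * y) := by
  classical
  induction u using MonoidAlgebra.induction_linear with
  | zero => simp
  | add u v hu hv => simp [hu, hv, Finset.sum_add_distrib]
  | single x c =>
    rw [quotMap_single]
    simp only [MonoidAlgebra.coeff_single, Finsupp.single_apply]
    by_cases h : (QuotientGroup.mk x : G ⧸ Z) = QuotientGroup.mk y
    · have hz : y * x⁻¹ ∈ Z := by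
        rw [← Subgroup.Normal.mem_comm_iff ‹Z.Normal›]
        exact QuotientGroup.eq.1 h
      rw [if_pos h, Finset.sum_eq_single ⟨y * x⁻¹, hz⟩]
      · simp
      · intro z _ hne
        refine if_neg fun hx => hne (Subtype.ext ?_)
        simp [hx]
      · simp
    · rw [if_neg h, Finset.sum_eq_zero]
      intro z _
      refine if_neg fun hx => h ?_
      rw [hx, QuotientGroup.mk_mul, QuotientGroup.mk_inv, (QuotientGroup.eq_one_iff _).2 z.2,
        inv_one, one_mul]

omit [Finite G] in
theorem quotMap_mem_center {u : ℂ[G]} (hu : u ∈ Subalgebra.center ℂ ℂ[G]) :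
    quotMap Z u ∈ Subalgebra.center ℂ ℂ[G ⧸ Z] := by
  refine mem_center_of_comm fun x => ?_
  obtain ⟨x, rfl⟩ := QuotientGroup.mk_surjective x
  rw [← quotMap_single, ← map_mul, ← map_mul, Subalgebra.mem_center_iff.1 hu]

theorem quotMap_bar (u : ℂ[G]) : quotMap Z (bar u) = bar (quotMap Z u) := by
  induction u using MonoidAlgebra.induction_linear with
  | zero =>
    have h : ∀ (H : Type _) [Group H] [Finite H], bar (0 : ℂ[H]) = 0 := fun H _ _ => by
      simpa using bar_smul 0 (0 : ℂ[H])
    rw [h, map_zero, h]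
  | add u v hu hv => rw [bar_add, map_add, map_add, bar_add, hu, hv]
  | single x c => rw [bar_single, quotMap_single, quotMap_single, bar_single, QuotientGroup.mk_inv]

/-- The projection of the center of the group algebra of `G` to that of `G/Z`. -/
def quotMapCenter (Z : Subgroup G) [Z.Normal] (u : Subalgebra.center ℂ ℂ[G]) :
    Subalgebra.center ℂ ℂ[G ⧸ Z] :=
  ⟨quotMap Z u, quotMap_mem_center u.2⟩

theorem sum_quotient_mk [Fintype G] [Fintype (G ⧸ Z)] (f : G ⧸ Z → ℂ) :
    ∑ x : G, f (QuotientGroup.mk x) = Nat.card Z * ∑ y, f y := by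
  classical
  have := Fintype.ofFinite Z
  have hmk : ∀ (y : G ⧸ Z) (z : Z), (QuotientGroup.mk (y.out * z : G) : G ⧸ Z) = y := fun y z => by
    rw [QuotientGroup.mk_mul, (QuotientGroup.eq_one_iff _).2 z.2, mul_one, QuotientGroup.out_eq']
  have hb : Function.Bijective fun s : (G ⧸ Z) × Z => (s.1.out * s.2 : G) := by
    refine ⟨?_, fun x => ?_⟩
    · rintro ⟨y, z⟩ ⟨y', z'⟩ h
      have h1 : y = y' := by rw [← hmk y z, ← hmk y' z']; exact congrArg QuotientGroup.mk h
      subst h1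
      exact Prod.ext rfl (Subtype.ext (mul_left_cancel h))
    · exact ⟨⟨QuotientGroup.mk x, _, QuotientGroup.eq.1 (QuotientGroup.out_eq' _)⟩,
        mul_inv_cancel_left _ _⟩
  rw [← hb.sum_comp, Fintype.sum_prod_type, Finset.mul_sum]
  simp [hmk]

/-- The coefficient of e_1 w at y is |Z|⁻¹ times that of the image of w at yZ. In the trace formula
the double sum over G is |Z|² times the one over G/Z, which cancels this factor and |G|⁻¹ =
|Z|⁻¹|G/Z|⁻¹. -/
theorem trace_idem_one_mul (hZ : Z ≤ Subgroup.center G) (w : Subalgebra.center ℂ ℂ[G]) :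
    Algebra.trace ℂ _ (idem hZ (1 : Z →* ℂ) * w) = Algebra.trace ℂ _ (quotMapCenter Z w) := by
  have := Fintype.ofFinite G
  have := Fintype.ofFinite Z
  have := Fintype.ofFinite (G ⧸ Z)
  have h1 : ∀ y : G, ((idem hZ (1 : Z →* ℂ) * w : Subalgebra.center ℂ ℂ[G]) : ℂ[G]).coeff y =
      (Nat.card Z : ℂ)⁻¹ * (quotMapCenter Z w : ℂ[G ⧸ Z]).coeff (QuotientGroup.mk y) := fun y => by
    refine (coeff_idemAux_mul _ _ _).trans ?_
    rw [quotMapCenter, coeff_quotMap_mk]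
    simp
  rw [trace_center_eq_sum, trace_center_eq_sum]
  simp only [h1]
  simp only [QuotientGroup.mk_mul, QuotientGroup.mk_inv, ← Finset.mul_sum]
  have h2 := sum_quotient_mk (Z := Z) fun x => ∑ g, (quotMapCenter Z w : ℂ[G ⧸ Z]).coeff
    (x * (g * x * g⁻¹)⁻¹)
  have h3 : ∀ x : G ⧸ Z, _ := fun x => sum_quotient_mk (Z := Z) fun g =>
    (quotMapCenter Z w : ℂ[G ⧸ Z]).coeff (x * (g * x * g⁻¹)⁻¹)
  simp only [h3, ← Finset.mul_sum]
  rw [h2, Subgroup.card_eq_card_quotient_mul_card_subgroup Z]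
  have hc : (Nat.card Z : ℂ) ≠ 0 := by exact_mod_cast Nat.card_pos.ne'
  push_cast
  field_simp

/-- The coefficient at a coset counts the elements of K in it; for the coset of x these are the z⁻¹x
with z in Ann(K). -/
theorem quotMapCenter_classSum (hZ : Z ≤ Subgroup.center G) (x : G) :
    quotMapCenter Z (classSum (ConjClasses.mk x)) =
      (Nat.card (ann Z (ConjClasses.mk x)) : ℂ) •
        classSum (ConjClasses.mk (QuotientGroup.mk x : G ⧸ Z)) := by
  classical
  have := Fintype.ofFinite Z
  have h1 : ∀ y : G, (quotMapCenter Z (classSum (ConjClasses.mk x)) : ℂ[G ⧸ Z]).coeff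
      (QuotientGroup.mk y) = ∑ z : Z, (classSum (ConjClasses.mk x) : ℂ[G]).coeff ((z : G)⁻¹ * y) :=
    fun y => coeff_quotMap_mk _ _
  refine Subtype.ext (MonoidAlgebra.ext (Finsupp.ext fun y => ?_))
  obtain ⟨y, rfl⟩ := QuotientGroup.mk_surjective y
  rw [SetLike.val_smul, MonoidAlgebra.coeff_smul, Finsupp.smul_apply, coeff_classSum, smul_eq_mul]
  split_ifs with h
  · rw [coeff_eq_of_mk_eq (quotMapCenter Z _).2 h, h1, mul_one,
      ← sum_mul_coeff_classSum hZ ConjClasses.mem_carrier_mk (fun _ => 1) fun _ _ => rfl]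
    simp
  · rw [h1, mul_zero]
    refine Finset.sum_eq_zero fun z _ => ?_
    rw [coeff_classSum, if_neg]
    intro hz
    refine h ?_
    rw [← quotClass_mk, ← quotClass_mk_inv_mul z, hz, quotClass_mk]

/-- The augmentation ε, applied to the image of the class sum, counts elements on both sides. -/
theorem card_carrier_eq_card_ann_mul (hZ : Z ≤ Subgroup.center G) (x : G) :
    Nat.card (ConjClasses.mk x).carrier = Nat.card (ann Z (ConjClasses.mk x)) *
      Nat.card (ConjClasses.mk (QuotientGroup.mk x : G ⧸ Z)).carrier := by
  classical
  have := Fintype.ofFinite G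
  have := Fintype.ofFinite Z
  have := Fintype.ofFinite (G ⧸ Z)
  let K := ConjClasses.mk x
  let ε : ∀ (H : Type _) [Group H], ℂ[H] →ₐ[ℂ] ℂ := fun H _ => MonoidAlgebra.lift ℂ ℂ H 1
  have h1 : (ε (G ⧸ Z)).comp (quotMap Z) = ε G := by
    refine MonoidAlgebra.algHom_ext (fun y => ?_) (AlgHom.ext fun c => ?_)
    · simp [quotMap_single, ε]
    · simp [MonoidAlgebra.singleOneAlgHom, quotMap_single, ε]
  have h2 : ∀ (H : Type _) [Group H] [Finite H] (K : ConjClasses H),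
      ε H (classSum K) = Nat.card K.carrier := fun H _ _ K => by
    have := Fintype.ofFinite H
    have h := sum_coeff_classSum K (fun _ => 1) 1 fun _ _ => rfl
    rw [mul_one] at h
    rw [← h, MonoidAlgebra.lift_apply, Finsupp.sum_fintype] <;> simp
  have h3 := congrArg (fun u : Subalgebra.center ℂ ℂ[G ⧸ Z] => ε (G ⧸ Z) (u : ℂ[G ⧸ Z]))
    (quotMapCenter_classSum hZ x)
  have h4 : ε (G ⧸ Z) (quotMap Z (classSum K : ℂ[G])) = ε G (classSum K) :=
    DFunLike.congr_fun h1 _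
  change ε (G ⧸ Z) (quotMap Z (classSum K : ℂ[G])) = ε (G ⧸ Z) (_ • _) at h3
  rw [h4, map_smul, h2, h2, smul_eq_mul] at h3
  exact_mod_cast h3

omit [Finite G] in
theorem basisIdx_one (g : ConjClasses (G ⧸ Z) → G) :
    ∀ j, j ∈ basisIdx g (1 : Z →* ℂ) := fun _ =>
  (mem_basisIdx _ _ _).2 fun _ _ => rfl

theorem gammaChar_one [Fintype (ConjClasses (G ⧸ Z))] (hZ : Z ≤ Subgroup.center G)
    (g : ConjClasses (G ⧸ Z) → G)
    (hg : ∀ j, ConjClasses.mk (QuotientGroup.mk (g j) : G ⧸ Z) = j) :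
    gammaChar hZ g (1 : Z →* ℂ) =
      (∏ j, (Nat.card (ann Z (ConjClasses.mk (g j))) : ℝ)) ^ 2 * gamma (G ⧸ Z) := by
  classical
  have h1 : (Matrix.of fun i j =>
      form (idem hZ (1 : Z →* ℂ) * classSum (ConjClasses.mk (g i)))
        (idem hZ (1 : Z →* ℂ) * classSum (ConjClasses.mk (g j)))) =
      Matrix.diagonal (fun j => (Nat.card (ann Z (ConjClasses.mk (g j))) : ℂ)) *
        (Matrix.of fun i j : ConjClasses (G ⧸ Z) => form (classSum i) (classSum j)) *
        Matrix.diagonal (fun j => (Nat.card (ann Z (ConjClasses.mk (g j))) : ℂ)) := by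
    ext i j
    have h2 : quotMapCenter Z (barCenter (classSum (ConjClasses.mk (g i))) *
        classSum (ConjClasses.mk (g j))) =
          barCenter (quotMapCenter Z (classSum (ConjClasses.mk (g i)))) *
            quotMapCenter Z (classSum (ConjClasses.mk (g j))) := by
      refine Subtype.ext ?_
      refine (map_mul (quotMap Z) _ _).trans ?_
      exact congrArg (· * _) (quotMap_bar _)
    rw [Matrix.mul_diagonal, Matrix.diagonal_mul, Matrix.of_apply, Matrix.of_apply, form_eq,
      barCenter_idem_mul_mul, if_pos rfl, mul_left_comm, trace_idem_one_mul, h2,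
      quotMapCenter_classSum hZ, quotMapCenter_classSum hZ, hg, hg, form_eq]
    simp
    ring
  have h3 := gram_reindex (Equiv.subtypeUnivEquiv (basisIdx_one g))
    (fun j => idem hZ (1 : Z →* ℂ) * classSum (ConjClasses.mk (g j)))
  refine Eq.trans h3 ?_
  rw [gram_eq, h1, Matrix.det_mul, Matrix.det_mul, Matrix.det_diagonal, gamma, gram_eq]
  simp only [norm_mul, norm_prod, RCLike.norm_natCast]
  ring

/-- Factor by factor, |C_G(g_j)||Ann(K_j)|/|Z| is the centralizer order in G/Z, because |K_j| is
|Ann(K_j)| times the size of j. -/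
theorem centChar_one [Fintype (ConjClasses (G ⧸ Z))] (hZ : Z ≤ Subgroup.center G)
    (g : ConjClasses (G ⧸ Z) → G)
    (hg : ∀ j, ConjClasses.mk (QuotientGroup.mk (g j) : G ⧸ Z) = j) :
    centChar g (1 : Z →* ℂ) = cent (G ⧸ Z) := by
  have := Fintype.ofFinite (basisIdx g (1 : Z →* ℂ))
  rw [centChar_eq, cent, finprod_eq_prod_of_fintype]
  refine Fintype.prod_equiv (Equiv.subtypeUnivEquiv (basisIdx_one g)) _ _ fun j => ?_
  set i := (Equiv.subtypeUnivEquiv (basisIdx_one g)) j with hi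
  have hij : (j : ConjClasses (G ⧸ Z)) = i := rfl
  rw [hij]
  have h1 := card_carrier_mul_card_centralizer (g i)
  have h2 := card_carrier_mul_card_centralizer (Quotient.out i : G ⧸ Z)
  rw [show ConjClasses.mk (Quotient.out i : G ⧸ Z) = i from Quotient.out_eq i] at h2
  rw [card_carrier_eq_card_ann_mul hZ, hg, Subgroup.card_eq_card_quotient_mul_card_subgroup Z,
    ← h2] at h1
  have h3 : (Nat.card i.carrier : ℝ) ≠ 0 := by exact_mod_cast card_carrier_ne_zero i
  have hc : (Nat.card Z : ℝ) ≠ 0 := by exact_mod_cast Nat.card_pos.ne'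
  have h4 : (Nat.card (ann Z (ConjClasses.mk (g i))) : ℝ) * Nat.card i.carrier *
      Nat.card (Subgroup.centralizer {g i}) = Nat.card i.carrier *
        Nat.card (Subgroup.centralizer {(Quotient.out i : G ⧸ Z)}) * Nat.card Z := by
    exact_mod_cast h1
  field_simp
  refine mul_left_cancel₀ h3 ?_
  linarith

theorem muChar_one [Fintype (ConjClasses (G ⧸ Z))] (hZ : Z ≤ Subgroup.center G)
    (g : ConjClasses (G ⧸ Z) → G)
    (hg : ∀ j, ConjClasses.mk (QuotientGroup.mk (g j) : G ⧸ Z) = j) :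
    muChar hZ g (1 : Z →* ℂ) =
      (∏ j, (Nat.card (ann Z (ConjClasses.mk (g j))) : ℝ)) ^ 2 * mu (G ⧸ Z) := by
  rw [muChar, gammaChar_one hZ g hg, centChar_one hZ g hg, mu, mul_div_assoc]

omit [Finite G] in
theorem prod_card_ann [Fintype (ConjClasses (G ⧸ Z))] {p : ℕ} [Fact p.Prime]
    (hp : Nat.card Z = p) (g : ConjClasses (G ⧸ Z) → G) :
    ∏ j, (Nat.card (ann Z (ConjClasses.mk (g j))) : ℝ) = (p : ℝ) ^ (idx g (⊤ : Subgroup Z)).ncard := by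
  classical
  have : Fact (Nat.card Z).Prime := by rw [hp]; infer_instance
  have h : ∀ j, (Nat.card (ann Z (ConjClasses.mk (g j))) : ℝ) =
      if j ∈ idx g (⊤ : Subgroup Z) then (p : ℝ) else 1 := fun j => by
    split_ifs with hj
    · rw [show ann Z (ConjClasses.mk (g j)) = ⊤ from hj, ← hp, Subgroup.card_top]
    · rw [(Subgroup.eq_bot_or_eq_top_of_prime_card (ann Z (ConjClasses.mk (g j)))).resolve_right hj]
      simp
  rw [Finset.prod_congr rfl fun j _ => h j, Finset.prod_ite, Finset.prod_const, Finset.prod_const_one,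
    mul_one, Set.ncard_eq_toFinset_card']
  congr 2
  ext j
  simp

end TrivialBlock

/-! ### Complex conjugate characters -/

section Conjugation

variable {G : Type*} [Group G] [Finite G] {Z : Subgroup G}

theorem trace_eq_conj_of_coeff_eq_conj {u v : Subalgebra.center ℂ ℂ[G]}
    (h : ∀ x, (v : ℂ[G]).coeff x = conj ((u : ℂ[G]).coeff x)) :
    Algebra.trace ℂ _ v = conj (Algebra.trace ℂ _ u) := by
  have := Fintype.ofFinite G
  rw [trace_center_eq_sum, trace_center_eq_sum]
  simp [h]

theorem coeff_mul_eq_conj {u v u' v' : ℂ[G]} (hu : ∀ x, u'.coeff x = conj (u.coeff x))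
    (hv : ∀ x, v'.coeff x = conj (v.coeff x)) (x : G) :
    (u' * v').coeff x = conj ((u * v).coeff x) := by
  have := Fintype.ofFinite G
  rw [coeff_mul_eq_sum, coeff_mul_eq_sum]
  simp [hu, hv]

theorem coeff_idem_mul_classSum_conj (hZ : Z ≤ Subgroup.center G) {χ ψ : Z →* ℂ}
    (h : ∀ z, ψ z = conj (χ z)) (K : ConjClasses G) (x : G) :
    ((idem hZ ψ * classSum K : Subalgebra.center ℂ ℂ[G]) : ℂ[G]).coeff x =
      conj (((idem hZ χ * classSum K : Subalgebra.center ℂ ℂ[G]) : ℂ[G]).coeff x) := by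
  classical
  have := Fintype.ofFinite Z
  refine (coeff_idemAux_mul _ _ _).trans (Eq.trans ?_ (congrArg conj (coeff_idemAux_mul _ _ _)).symm)
  simp [h, coeff_classSum, apply_ite conj]

variable [Z.Normal]

/-- Conjugating coefficients fixes class sums and exchanges the two idempotents, so the Gram matrix
is conjugated and its determinant keeps its absolute value. The kernels, hence the index sets and
the denominators, coincide. -/
theorem muChar_congr_conj (hZ : Z ≤ Subgroup.center G) (g : ConjClasses (G ⧸ Z) → G)
    {χ ψ : Z →* ℂ} (h : ∀ z, ψ z = conj (χ z)) : muChar hZ g ψ = muChar hZ g χ := by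
  classical
  have hker : charKer ψ = charKer χ := by
    ext z
    change ψ z = ψ 1 ↔ χ z = χ 1
    rw [h, h, (starRingEnd ℂ).injective.eq_iff]
  have hidx : ∀ j, j ∈ basisIdx g ψ ↔ j ∈ basisIdx g χ := fun j => by
    rw [mem_basisIdx, mem_basisIdx, hker]
  have hform : ∀ K L : ConjClasses G, form (idem hZ ψ * classSum K) (idem hZ ψ * classSum L) =
      conj (form (idem hZ χ * classSum K) (idem hZ χ * classSum L)) := fun K L => by
    refine trace_eq_conj_of_coeff_eq_conj fun x => coeff_mul_eq_conj (fun y => ?_)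
      (coeff_idem_mul_classSum_conj hZ h L) x
    rw [coeff_bar, coeff_bar, coeff_idem_mul_classSum_conj hZ h]
  have hcent : centChar g ψ = centChar g χ := by
    simp only [centChar, hker]
  have hgamma : gammaChar hZ g ψ = gammaChar hZ g χ := by
    have := Fintype.ofFinite (basisIdx g χ)
    refine (gram_reindex (Equiv.subtypeEquivRight hidx)
      (fun j : basisIdx g χ => idem hZ ψ * classSum (ConjClasses.mk (g j)))).trans ?_
    rw [gammaChar, gram_eq, gram_eq, ← RCLike.norm_conj (Matrix.det _), RingHom.map_det]
    refine congrArg (fun M : Matrix _ _ ℂ => ‖M.det‖) (Matrix.ext fun i j => ?_)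
    simp [hform]
  rw [muChar, muChar, hgamma, hcent]

theorem muChar_nonneg (hZ : Z ≤ Subgroup.center G) (g : ConjClasses (G ⧸ Z) → G) (φ : Z → ℂ) :
    0 ≤ muChar hZ g φ := by
  have := Fintype.ofFinite (basisIdx g φ)
  refine div_nonneg (norm_nonneg _) ?_
  rw [centChar_eq]
  positivity

end Conjugation

/-! ### Products over exponents and the main theorem -/

section Main

theorem prod_units_zmod {p : ℕ} [Fact p.Prime] (f : ℕ → ℝ) :
    ∏ a : (ZMod p)ˣ, f (a : ZMod p).val = ∏ a ∈ Finset.Ico 1 p, f a := by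
  refine Finset.prod_bij (fun a _ => (a : ZMod p).val) (fun a _ => ?_) (fun a _ b _ h => ?_)
    (fun b hb => ?_) fun _ _ => rfl
  · rw [Finset.mem_Ico]
    exact ⟨Nat.one_le_iff_ne_zero.2 ((ZMod.val_ne_zero _).2 a.ne_zero), ZMod.val_lt _⟩
  · exact Units.ext (ZMod.val_injective p h)
  · rw [Finset.mem_Ico] at hb
    have h : ((b : ZMod p)).val = b := ZMod.val_cast_of_lt hb.2
    refine ⟨Units.mk0 (b : ZMod p) fun h0 => ?_, Finset.mem_univ _, h⟩
    rw [h0, ZMod.val_zero] at h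
    omega

theorem prod_Ico_eq_sq {p : ℕ} [hp : Fact p.Prime] (h2 : 2 < p) (f : ℕ → ℝ)
    (hf : ∀ a ∈ Finset.Ico 1 p, f (p - a) = f a) :
    ∏ a ∈ Finset.Ico 1 p, f a = (∏ a ∈ Finset.Icc 1 ((p - 1) / 2), f a) ^ 2 := by
  obtain ⟨m, hm⟩ := hp.out.odd_of_ne_two h2.ne'
  have h1 : (p - 1) / 2 = m := by omega
  have h3 : Finset.Icc 1 ((p - 1) / 2) = Finset.Ico 1 (m + 1) := by
    ext a
    rw [h1, Finset.mem_Icc, Finset.mem_Ico]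
    omega
  rw [h3, ← Finset.prod_Ico_consecutive f (show 1 ≤ m + 1 by omega) (show m + 1 ≤ p by omega), sq]
  congr 1
  -- With p = 2m + 1, the reflection a ↦ p - a exchanges the upper half [m + 1, 2m] and the lower
  -- half [1, m].
  refine Finset.prod_bij' (fun a _ => p - a) (fun a _ => p - a) ?_ ?_ ?_ ?_ ?_ <;>
    intro a ha <;> rw [Finset.mem_Ico] at ha
  · rw [Finset.mem_Ico]; omega
  · rw [Finset.mem_Ico]; omega
  · omega
  · omega
  · exact (hf a (Finset.mem_Ico.2 ⟨by omega, by omega⟩)).symm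

end Main

end Harada

end

theorem mainTheorem5 {G : Type*} [Group G] [Finite G] (p : ℕ) [Fact p.Prime]
    (Z : Subgroup G) [Z.Normal] (hZ : Z ≤ Subgroup.center G) (hp : Nat.card Z = p)
    (g : ConjClasses (G ⧸ Z) → G)
    (hg : ∀ j : ConjClasses (G ⧸ Z), ConjClasses.mk (QuotientGroup.mk (g j) : G ⧸ Z) = j)
    (φ : Z → ℂ) (hφ : φ ∈ Harada.Irr Z) (hφ1 : φ ≠ 1) :
    Harada.mu G =
        (p : ℝ) ^ (2 * (Harada.idx g (⊤ : Subgroup Z)).ncard) * Harada.mu (G ⧸ Z) *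
          ∏ a : (ZMod p)ˣ, Harada.muChar hZ g (φ ^ (a : ZMod p).val) ∧
      (2 < p →
        Harada.harada G =
          (p : ℂ) ^ (Harada.idx g (⊤ : Subgroup Z)).ncard * Harada.harada (G ⧸ Z) *
            ∏ a ∈ Finset.Icc 1 ((p - 1) / 2), (Harada.muChar hZ g (φ ^ a) : ℂ)) := by
  have hcomm : IsMulCommutative Z :=
    ⟨⟨fun a b => Subtype.ext (Subgroup.mem_center_iff.1 (hZ b.2) a)⟩⟩
  obtain ⟨ψ, rfl⟩ := Harada.exists_monoidHom_of_mem_Irr hφ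
  have hψ : ψ ≠ 1 := fun h => hφ1 (by rw [h]; rfl)
  have := Fintype.ofFinite (ConjClasses (G ⧸ Z))
  obtain ⟨σ, hσ⟩ := Harada.exists_equiv_sigma_basisIdx hZ hp hψ g hg
  have h1 : Harada.mu G = (p : ℝ) ^ (2 * (Harada.idx g (⊤ : Subgroup Z)).ncard) *
      Harada.mu (G ⧸ Z) * ∏ a ∈ Finset.Ico 1 p, Harada.muChar hZ g (ψ ^ a : Z →* ℂ) := by
    -- The powers of ψ with exponent below p index the blocks; the exponent 0 is split off and
    -- evaluated through G/Z.
    rw [Harada.mu_eq_prod_muChar hZ g hg _ (Harada.pow_fin_injective hp hψ) σ hσ,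
      Fin.prod_univ_eq_prod_range (fun a => Harada.muChar hZ g (ψ ^ a : Z →* ℂ)) p,
      Finset.range_eq_Ico, Finset.prod_eq_prod_Ico_succ_bot (Fact.out : p.Prime).pos, pow_zero,
      Harada.muChar_one hZ g hg, Harada.prod_card_ann hp, ← pow_mul, mul_comm 2]
  refine ⟨?_, fun h2 => ?_⟩
  · rw [h1, ← Harada.prod_units_zmod]
    rfl
  · rw [Harada.prod_Ico_eq_sq h2] at h1
    · obtain ⟨r, hr, hr1, hr2⟩ := Harada.exists_harada_sq G
      obtain ⟨s, hs, hs1, hs2⟩ := Harada.exists_harada_sq (G ⧸ Z)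
      have h3 : r = (p : ℝ) ^ (Harada.idx g (⊤ : Subgroup Z)).ncard * s *
          ∏ a ∈ Finset.Icc 1 ((p - 1) / 2), Harada.muChar hZ g (ψ ^ a : Z →* ℂ) := by
        refine (pow_left_inj₀ hr (mul_nonneg (by positivity)
          (Finset.prod_nonneg fun a _ => Harada.muChar_nonneg hZ g _)) two_ne_zero).1 ?_
        rw [← hr2, h1, hs2]
        ring
      rw [hr1, hs1, h3]
      push_cast
      rfl
    · intro a ha
      rw [Finset.mem_Ico] at ha
      refine Harada.muChar_congr_conj hZ g fun z => ?_
      -- Since ψ has order p, ψ ^ (p - a) is inverse, hence complex conjugate, to ψ ^ a.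
      have hz : (ψ ^ (p - a)) z * (ψ ^ a) z = 1 := by
        rw [← MonoidHom.mul_apply, ← pow_add, Nat.sub_add_cancel ha.2.le,
          ← Harada.orderOf_eq_of_ne_one hp hψ, pow_orderOf_eq_one, MonoidHom.one_apply]
      have hz2 : (ψ ^ a) z⁻¹ * (ψ ^ a) z = 1 := by rw [← map_mul, inv_mul_cancel, map_one]
      rw [Harada.conj_hom_apply]
      exact mul_right_cancel₀ (right_ne_zero_of_mul_eq_one hz) (hz.trans hz2.symm)
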